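/- Let $L$ be the free Lie algebra over $\mathbb{C}$ on three generators $a,b,c$, and let $L_n$ be its homogeneous subspace of degree $n$, spanned by all bracketings of $n$ generators. Identify $a,b,c$ with the standard basis of $\mathbb{C}^3$, let $\mathfrak{sl}_3(\mathbb{C})$ act on $L_1=\mathbb{C}^3$ by matrix-vector multiplication, and extend this action to $L$ by derivations: $D.[t,u]=[D.t,u]+[t,D.u]$. Let $J=\{Z\in L : D.Z=0 \text{ for all } D\in\mathfrak{sl}_3(\mathbb{C})\}$ be the Lie subalgebra of invariants and let $J_n=J\cap L_n$. An element of $J_n$ is called primitive if it does not lie in the Lie subalgebra of $L$ generated by $\bigcup_{k<n}J_k$. Theorem. The space $J_{12}$ of invariants of degree $12$ has dimension $35$. The minimal degree of a nonzero invariant is $9$; that is, $J_9\neq 0$ and $J_n=0$ for all $n<9$. Every nonzero invariant of degree $12$ is primitive. -/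

import Mathlib

noncomputable section

namespace FreeLieInvariants

/-! ### Derivations of a free Lie algebra

A map from the generators to the free Lie algebra extends uniquely to a derivation. It is obtained
from the universal property applied to the Lie algebra `L ⊕ ε L` with `ε ^ 2 = 0`. -/

/-- The Lie algebra `L ⊕ ε L` with `ε ^ 2 = 0`; an element is `fst + ε snd`. -/
@[ext] structure SqZero (L : Type*) where
  /-- The coefficient of `1`. -/
  fst : L
  /-- The coefficient of `ε`. -/
  snd : L

namespace SqZero

/-- The underlying product. -/
def toProd (L : Type*) : SqZero L ≃ L × L where
  toFun u := (u.fst, u.snd)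
  invFun p := ⟨p.1, p.2⟩

variable {R L : Type*} [CommRing R] [LieRing L] [LieAlgebra R L]

instance : AddCommGroup (SqZero L) := (toProd L).addCommGroup

instance : Module R (SqZero L) := (toProd L).module R

@[simp] theorem fst_add (u v : SqZero L) : (u + v).fst = u.fst + v.fst := rfl

@[simp] theorem snd_add (u v : SqZero L) : (u + v).snd = u.snd + v.snd := rfl

@[simp] theorem fst_zero : (0 : SqZero L).fst = 0 := rfl

@[simp] theorem snd_zero : (0 : SqZero L).snd = 0 := rfl

@[simp] theorem fst_smul (r : R) (u : SqZero L) : (r • u).fst = r • u.fst := rfl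

@[simp] theorem snd_smul (r : R) (u : SqZero L) : (r • u).snd = r • u.snd := rfl

instance : Bracket (SqZero L) (SqZero L) :=
  ⟨fun u v => ⟨⁅u.fst, v.fst⁆, ⁅u.fst, v.snd⁆ + ⁅u.snd, v.fst⁆⟩⟩

@[simp] theorem fst_lie (u v : SqZero L) : ⁅u, v⁆.fst = ⁅u.fst, v.fst⁆ := rfl

@[simp] theorem snd_lie (u v : SqZero L) : ⁅u, v⁆.snd = ⁅u.fst, v.snd⁆ + ⁅u.snd, v.fst⁆ := rfl

instance : LieRing (SqZero L) where
  add_lie u v w := by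
    ext
    · simp
    · simp; abel
  lie_add u v w := by
    ext
    · simp
    · simp; abel
  lie_self u := by
    ext
    · simp
    · simp only [snd_lie, snd_zero]
      rw [← lie_skew u.fst u.snd]
      abel
  leibniz_lie u v w := by
    ext
    · simp
    · simp only [snd_lie, fst_lie, snd_add, lie_add, add_lie, lie_lie]
      abel

instance : LieAlgebra R (SqZero L) where
  lie_smul r u v := by
    ext
    · simp
    · simp

/-- The projection `x + ε y ↦ x`. -/
def fstHom : SqZero L →ₗ⁅R⁆ L where
  toFun u := u.fst
  map_add' _ _ := rfl
  map_smul' _ _ := rfl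
  map_lie' := rfl

end SqZero

section Derivation

variable {R X : Type*} [CommRing R]

/-- Two derivations of a free Lie algebra which agree on the generators are equal. -/
theorem derivation_ext {D₁ D₂ : LieDerivation R (FreeLieAlgebra R X) (FreeLieAlgebra R X)}
    (h : ∀ x, D₁ (FreeLieAlgebra.of R x) = D₂ (FreeLieAlgebra.of R x)) : D₁ = D₂ := by
  let F (D : LieDerivation R (FreeLieAlgebra R X) (FreeLieAlgebra R X)) :
      FreeLieAlgebra R X →ₗ⁅R⁆ SqZero (FreeLieAlgebra R X) :=
    { toFun := fun z => ⟨z, D z⟩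
      map_add' := fun _ _ => SqZero.ext rfl (map_add D _ _)
      map_smul' := fun _ _ => SqZero.ext rfl (map_smul D _ _)
      map_lie' := SqZero.ext rfl (D.apply_lie_eq_add _ _) }
  have hF : F D₁ = F D₂ := FreeLieAlgebra.hom_ext fun x => SqZero.ext rfl (h x)
  ext z
  exact congrArg (fun G => (G z).snd) hF

/-- The homomorphism `z ↦ z + ε D z`, where `D` is the derivation extending `f`. -/
def derivationAux (f : X → FreeLieAlgebra R X) :
    FreeLieAlgebra R X →ₗ⁅R⁆ SqZero (FreeLieAlgebra R X) :=
  FreeLieAlgebra.lift R fun x => ⟨FreeLieAlgebra.of R x, f x⟩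

theorem derivationAux_fst (f : X → FreeLieAlgebra R X) (z : FreeLieAlgebra R X) :
    (derivationAux f z).fst = z := by
  have h : SqZero.fstHom.comp (derivationAux f) = LieHom.id := by
    refine FreeLieAlgebra.hom_ext fun x => ?_
    change (derivationAux f (FreeLieAlgebra.of R x)).fst = FreeLieAlgebra.of R x
    rw [derivationAux, FreeLieAlgebra.lift_of_apply]
  exact LieHom.congr_fun h z

/-- The derivation of the free Lie algebra on `X` with prescribed values on the generators. -/
def derivation (f : X → FreeLieAlgebra R X) :
    LieDerivation R (FreeLieAlgebra R X) (FreeLieAlgebra R X) where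
  toFun z := (derivationAux f z).snd
  map_add' z w := by rw [map_add, SqZero.snd_add]
  map_smul' r z := by rw [map_smul, SqZero.snd_smul, RingHom.id_apply]
  leibniz' z w := by
    change (derivationAux f ⁅z, w⁆).snd = ⁅z, (derivationAux f w).snd⁆ - ⁅w, (derivationAux f z).snd⁆
    rw [LieHom.map_lie, SqZero.snd_lie, derivationAux_fst, derivationAux_fst,
      ← lie_skew w, sub_neg_eq_add]

@[simp] theorem derivation_of (f : X → FreeLieAlgebra R X) (x : X) :
    derivation f (FreeLieAlgebra.of R x) = f x := by
  change (derivationAux f (FreeLieAlgebra.of R x)).snd = f x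
  rw [derivationAux, FreeLieAlgebra.lift_of_apply]

end Derivation

/-! ### The natural action of `sl₃(ℂ)` on the free Lie algebra on three generators -/

/-- The free Lie algebra over `ℂ` on three generators `a, b, c` (indexed by `0, 1, 2`). -/
abbrev L : Type := FreeLieAlgebra ℂ (Fin 3)

/-- The generators of the free Lie algebra. -/
abbrev gen (j : Fin 3) : L := FreeLieAlgebra.of ℂ j

section Action

attribute [local instance] LieRing.ofAssociativeRing

/-- The action of `sl₃(ℂ)` on `L` by derivations. On the generators, identified with the standard
basis of `ℂ³`, a matrix `A` acts by matrix-vector multiplication: `A · e_j = ∑ i, A i j e_i`. -/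
def naturalAction : LieAlgebra.SpecialLinear.sl (Fin 3) ℂ →ₗ⁅ℂ⁆ LieDerivation ℂ L L where
  toFun A := derivation fun j => ∑ i, A.val i j • gen i
  map_add' A B := derivation_ext fun j => by
    simp [add_smul, Finset.sum_add_distrib]
  map_smul' r A := derivation_ext fun j => by
    simp [mul_smul, Finset.smul_sum]
  map_lie' {A B} := derivation_ext fun j => by
    simp only [derivation_of, LieDerivation.lie_apply, LieAlgebra.SpecialLinear.sl_bracket,
      map_sum, map_smul, Matrix.sub_apply, Matrix.mul_apply, Finset.smul_sum, smul_smul]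
    simp only [sub_smul, Finset.sum_smul, Finset.sum_sub_distrib]
    congr 1
    · rw [Finset.sum_comm]
      exact Finset.sum_congr rfl fun _ _ => Finset.sum_congr rfl fun _ _ => by rw [mul_comm]
    · rw [Finset.sum_comm]
      exact Finset.sum_congr rfl fun _ _ => Finset.sum_congr rfl fun _ _ => by rw [mul_comm]

/-- The Lie subalgebra of invariants: the `Z ∈ L` with `D · Z = 0` for all `D ∈ sl₃(ℂ)`. -/
def invariants : LieSubalgebra ℂ L where
  carrier := {Z | ∀ D : LieAlgebra.SpecialLinear.sl (Fin 3) ℂ, naturalAction D Z = 0}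
  add_mem' hZ hW D := by rw [map_add, hZ D, hW D, add_zero]
  zero_mem' D := map_zero _
  smul_mem' r Z hZ D := by rw [map_smul, hZ D, smul_zero]
  lie_mem' {Z W} hZ hW D := by
    rw [LieDerivation.apply_lie_eq_add, hZ D, hW D, lie_zero, zero_lie, add_zero]

end Action

/-! ### Degree and primitivity -/

/-- The Lie polynomial of a nonassociative word: each product is read as a Lie bracket. -/
def bracketing : FreeMagma (Fin 3) → L
  | .of j => gen j
  | .mul t u => ⁅bracketing t, bracketing u⁆

/-- The homogeneous subspace `L_n`, spanned by the bracketings of all nonassociative words of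
degree (length) `n`. -/
def homogeneous (n : ℕ) : Submodule ℂ L :=
  Submodule.span ℂ (bracketing '' {t | t.length = n})

/-- The space of invariants of degree `n`. -/
def invariantsOfDegree (n : ℕ) : Submodule ℂ L :=
  invariants.toSubmodule ⊓ homogeneous n

/-- The Lie subalgebra generated by the homogeneous invariants of degree less than `n`. -/
def lowerInvariants (n : ℕ) : LieSubalgebra ℂ L :=
  LieSubalgebra.lieSpan ℂ L {Z | ∃ k < n, Z ∈ invariantsOfDegree k}

/-- An invariant of degree `n` is primitive if it does not lie in the Lie subalgebra generated by
the invariants of lower degree. -/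
def IsPrimitive (n : ℕ) (Z : L) : Prop :=
  Z ∈ invariantsOfDegree n ∧ Z ∉ lowerInvariants n

end FreeLieInvariants

end

/-!
Write `T` for the free associative algebra on `a, b, c`, let `toT : L → T` be the canonical
homomorphism, and let `dynkin : T → L` send a word to its right-normed bracket. The action of `L` on
`ℂ ⊕ L` by `x · (c, y) = (0, c deg(x) x + [x, y])` extends to `T`, and evaluating at `(1, 0)` shows
that `dynkin ∘ toT` multiplies by the degree (`dynkin_toT`). This makes `toT` injective in positive
degree, and turns the dimension of a weight space of `L_n` into `1 / n` times the trace of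
`toT ∘ dynkin` on the words of that weight (`weightSpace_trace`).

The trace is a signed sum, over `2 ^ (n - 1)` permutations of the positions, of the numbers of fixed
words of the given weight. As a symmetric function it is a signed sum of products of power sums
indexed by cycle types (`sum_selfCoeff`). For `n = 3, 6, 9, 12` the cycle types are collected by
evaluation; all cancel but `d ^ (n / d)` with multiplicity `μ(d)`, as in Witt's formula.

The invariants of degree `3 k` are counted from the weight multiplicities by an index. On the part of
weight `(k, k, k)` of `L ⊗ Λ(𝔫*)`, with `𝔫` spanned by the three positive root vectors, the Dirac
operator `d + d*` maps the even to the odd part and, by Kostant's formula, has as square half the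
Casimir operator (`codirac_dirac`, `dirac_codirac`). Since the matrix units `E i j` and `E j i` act on
`T` as adjoint operators for the Hermitian form with orthonormal words, the Casimir operator vanishes
only on invariants (`unitAct_eq_zero`). So the Dirac operator is surjective, its kernel is the space
of invariants, and the dimension of the latter is an alternating sum of six weight multiplicities
(`finrank_invariantsOfDegree`): `0, 0, 4, 35` in degrees `3, 6, 9, 12`. In a degree prime to three the
weight `(n / 3, n / 3, n / 3)` does not occur.

Below degree `12` the invariants therefore live in degree `9` only, and they generate a Lie algebra
with components in degrees `9` and at least `18`. It meets `L_12` in `0`, which makes every nonzero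
invariant of degree `12` primitive.
-/

noncomputable section

namespace FreeLieInvariants

attribute [local instance] LieRing.ofAssociativeRing

/-! ### The free associative algebra and the Dynkin operator -/

/-- The free associative algebra on the generators `a, b, c`, as the algebra of words. -/
abbrev T : Type := MonoidAlgebra ℂ (FreeMonoid (Fin 3))

/-- The word `w` as an element of the free associative algebra. -/
def mon (w : List (Fin 3)) : T := MonoidAlgebra.single (FreeMonoid.ofList w) 1

/-- The coefficient of the word `w`. -/
def co (w : List (Fin 3)) : T →ₗ[ℂ] ℂ where
  toFun F := F.coeff (FreeMonoid.ofList w)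
  map_add' _ _ := rfl
  map_smul' _ _ := rfl

theorem ext_co {F G : T} (h : ∀ w, co w F = co w G) : F = G := by
  apply MonoidAlgebra.coeff_injective
  ext w
  exact h (FreeMonoid.toList w)

theorem ext_mon {N : Type*} [AddCommGroup N] [Module ℂ N] {f g : T →ₗ[ℂ] N}
    (h : ∀ w, f (mon w) = g (mon w)) : f = g := by
  refine MonoidAlgebra.lhom_ext' fun w => LinearMap.ext_ring ?_
  exact h (FreeMonoid.toList w)

theorem co_mon (u w : List (Fin 3)) : co w (mon u) = if u = w then 1 else 0 := by
  classical
  change Finsupp.single (FreeMonoid.ofList u) (1 : ℂ) (FreeMonoid.ofList w) = _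
  rw [Finsupp.single_apply]
  simp

theorem mon_append (u v : List (Fin 3)) : mon (u ++ v) = mon u * mon v := by
  simp [mon, MonoidAlgebra.single_mul_single]

theorem mon_cons (x : Fin 3) (v : List (Fin 3)) : mon (x :: v) = mon [x] * mon v :=
  mon_append [x] v

theorem mon_nil : mon [] = 1 := rfl

theorem co_mul_nil (x : Fin 3) (F : T) : co [] (mon [x] * F) = 0 := by
  have : (co []).comp (LinearMap.mulLeft ℂ (mon [x])) = 0 := ext_mon fun w => by
    simp [← mon_cons, co_mon]
  exact LinearMap.congr_fun this F

theorem co_mul_cons (x y : Fin 3) (w : List (Fin 3)) (F : T) :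
    co (y :: w) (mon [x] * F) = if x = y then co w F else 0 := by
  have : (co (y :: w)).comp (LinearMap.mulLeft ℂ (mon [x])) =
      if x = y then co w else 0 := ext_mon fun u => by
    split_ifs with h <;> simp [← mon_cons, co_mon, h]
  rw [← LinearMap.mulLeft_apply (R := ℂ), ← LinearMap.comp_apply, this]
  split_ifs <;> rfl

/-- The linear extension of a function on words. -/
def wordExt {N : Type*} [AddCommGroup N] [Module ℂ N] (f : List (Fin 3) → N) : T →ₗ[ℂ] N :=
  (Finsupp.lift N ℂ (FreeMonoid (Fin 3)) fun w => f (FreeMonoid.toList w)) ∘ₗ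
    (MonoidAlgebra.coeffLinearEquiv ℂ).toLinearMap

@[simp] theorem wordExt_mon {N : Type*} [AddCommGroup N] [Module ℂ N] (f : List (Fin 3) → N)
    (w : List (Fin 3)) : wordExt f (mon w) = f w := by
  simp [wordExt, mon]

theorem eq_finsum_co (F : T) : ∃ s : Finset (List (Fin 3)), F = ∑ w ∈ s, co w F • mon w := by
  classical
  refine ⟨F.coeff.support.image FreeMonoid.toList, ?_⟩
  apply ext_co
  intro u
  simp only [map_sum, map_smul, co_mon, smul_eq_mul, mul_ite, mul_one, mul_zero,
    Finset.sum_ite_eq']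
  split_ifs with h
  · rfl
  · by_contra hne
    apply h
    rw [Finset.mem_image]
    exact ⟨FreeMonoid.ofList u, Finsupp.mem_support_iff.2 hne, rfl⟩

/-- Induction on the generation of a free Lie algebra. -/
theorem free_induction {p : L → Prop} (of : ∀ i, p (gen i)) (add : ∀ x y, p x → p y → p (x + y))
    (smul : ∀ (r : ℂ) x, p x → p (r • x)) (lie : ∀ x y, p x → p y → p ⁅x, y⁆) (x : L) : p x := by
  let S : LieSubalgebra ℂ L :=
    { carrier := {x | p x}
      add_mem' := fun {x y} hx hy => add x y hx hy
      zero_mem' := by simpa using smul 0 _ (of 0)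
      smul_mem' := fun r x hx => smul r x hx
      lie_mem' := fun {x y} hx hy => lie x y hx hy }
  have h : S.incl.comp (FreeLieAlgebra.lift ℂ fun i => (⟨gen i, of i⟩ : S)) = LieHom.id :=
    FreeLieAlgebra.hom_ext fun i => by simp [gen]
  have hx := LieHom.congr_fun h x
  simp only [LieHom.comp_apply, LieHom.id_apply] at hx
  rw [← hx]
  exact (FreeLieAlgebra.lift ℂ (fun i => (⟨gen i, of i⟩ : S)) x).2

/-- The homomorphism from the free Lie algebra to the free associative algebra. -/
def toT : L →ₗ⁅ℂ⁆ T := FreeLieAlgebra.lift ℂ fun i => mon [i]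

@[simp] theorem toT_gen (i : Fin 3) : toT (gen i) = mon [i] := by
  simp [toT, gen]

theorem toT_lie (x y : L) : toT ⁅x, y⁆ = toT x * toT y - toT y * toT x := by
  rw [LieHom.map_lie, LieRing.of_associative_ring_bracket]

/-- The Euler derivation, which multiplies by the degree. -/
def euler : LieDerivation ℂ L L := derivation gen

@[simp] theorem euler_gen (i : Fin 3) : euler (gen i) = gen i := derivation_of _ _

/-- The right-normed bracket `[x₁, [x₂, …, [xₙ₋₁, xₙ]]]` of a word. -/
def rightBracket : List (Fin 3) → L
  | [] => 0
  | [i] => gen i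
  | i :: j :: w => ⁅gen i, rightBracket (j :: w)⁆

/-- The action of an element `x` of the free Lie algebra on `ℂ ⊕ L`, the extension of the adjoint
representation by the cocycle `euler`. -/
def extendedAd : L →ₗ⁅ℂ⁆ Module.End ℂ (ℂ × L) where
  toFun x := LinearMap.inr ℂ ℂ L ∘ₗ
    (LinearMap.coprod (LinearMap.toSpanSingleton ℂ L (euler x)) (LieAlgebra.ad ℂ L x))
  map_add' x y := by
    ext <;> simp
  map_smul' r x := by
    ext <;> simp
  map_lie' {x y} := by
    ext <;> simp [LieRing.of_associative_ring_bracket]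

/-- The extension of `extendedAd` to the free associative algebra. -/
def extendedAdT : T →ₐ[ℂ] Module.End ℂ (ℂ × L) :=
  MonoidAlgebra.lift ℂ _ _ (FreeMonoid.lift fun i => extendedAd (gen i))

theorem extendedAdT_mon_single (i : Fin 3) : extendedAdT (mon [i]) = extendedAd (gen i) := by
  simp [extendedAdT, mon]

theorem extendedAdT_toT (x : L) : extendedAdT (toT x) = extendedAd x := by
  have h : extendedAdT.toLieHom.comp toT = extendedAd :=
    FreeLieAlgebra.hom_ext fun i => by
      simpa using extendedAdT_mon_single i
  exact LieHom.congr_fun h x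

/-- The linear map from the free associative algebra to the free Lie algebra which sends a
nonempty word to its right-normed bracket (`dynkin_mon`). It is defined as the orbit map of `(1, 0)`
under `extendedAdT`, so that its value on the image of `L` can be read off. -/
def dynkin : T →ₗ[ℂ] L :=
  LinearMap.snd ℂ ℂ L ∘ₗ LinearMap.applyₗ (1, 0) ∘ₗ extendedAdT.toLinearMap

/-- The theorem of Dynkin, Specht and Wever. -/
theorem dynkin_toT (x : L) : dynkin (toT x) = euler x := by
  simp [dynkin, extendedAdT_toT, extendedAd]

theorem extendedAdT_mon (i : Fin 3) (w : List (Fin 3)) :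
    extendedAdT (mon (i :: w)) (1, 0) = (0, rightBracket (i :: w)) := by
  induction w generalizing i with
  | nil => simp [extendedAdT_mon_single, extendedAd, rightBracket]
  | cons j w ih =>
    rw [mon_cons, map_mul, Module.End.mul_apply, ih, extendedAdT_mon_single]
    simp [extendedAd, rightBracket]

theorem dynkin_mon (w : List (Fin 3)) : dynkin (mon w) = rightBracket w := by
  cases w with
  | nil => simp [dynkin, mon_nil, rightBracket]
  | cons i w => simp [dynkin, extendedAdT_mon]

/-! ### Words and weights -/

/-- The subspace of `T` spanned by the words satisfying `P`. -/
def supp (P : List (Fin 3) → Prop) : Submodule ℂ T where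
  carrier := {F | ∀ w, co w F ≠ 0 → P w}
  add_mem' {F G} hF hG w h := by
    by_cases h1 : co w F = 0
    · exact hG w fun h2 => h (by rw [map_add, h1, h2, add_zero])
    · exact hF w h1
  zero_mem' w h := absurd (map_zero _) h
  smul_mem' r F hF w h := hF w fun h1 => h (by rw [map_smul, h1, smul_zero])

theorem mon_mem_supp {P : List (Fin 3) → Prop} {w : List (Fin 3)} (h : P w) : mon w ∈ supp P := by
  intro u hu
  rw [co_mon] at hu
  simp only [ne_eq, ite_eq_right_iff, one_ne_zero, imp_false, not_not] at hu
  exact hu ▸ h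

theorem supp_eq_span (P : List (Fin 3) → Prop) :
    supp P = Submodule.span ℂ (mon '' {w | P w}) := by
  apply le_antisymm
  · intro F hF
    obtain ⟨s, hs⟩ := eq_finsum_co F
    rw [hs]
    refine Submodule.sum_mem _ fun w _ => ?_
    by_cases h : co w F = 0
    · rw [h, zero_smul]
      exact zero_mem _
    · exact Submodule.smul_mem _ _ (Submodule.subset_span ⟨w, hF w h, rfl⟩)
  · rw [Submodule.span_le]
    rintro _ ⟨w, hw, rfl⟩
    exact mon_mem_supp hw

theorem mul_mem_supp {P Q R : List (Fin 3) → Prop} (h : ∀ u v, P u → Q v → R (u ++ v))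
    {F G : T} (hF : F ∈ supp P) (hG : G ∈ supp Q) : F * G ∈ supp R := by
  rw [supp_eq_span] at hF hG
  induction hF using Submodule.span_induction with
  | zero => rw [zero_mul]; exact zero_mem _
  | add x y _ _ hx hy => rw [add_mul]; exact add_mem hx hy
  | smul r x _ hx => rw [smul_mul_assoc]; exact Submodule.smul_mem _ _ hx
  | mem x hx =>
    obtain ⟨u, hu, rfl⟩ := hx
    induction hG using Submodule.span_induction with
    | zero => rw [mul_zero]; exact zero_mem _
    | add x y _ _ hx hy => rw [mul_add]; exact add_mem hx hy
    | smul r x _ hx => rw [mul_smul_comm]; exact Submodule.smul_mem _ _ hx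
    | mem y hy =>
      obtain ⟨v, hv, rfl⟩ := hy
      rw [← mon_append]
      exact mon_mem_supp (h u v hu hv)

theorem toT_bracketing (t : FreeMagma (Fin 3)) :
    toT (bracketing t) ∈ supp fun w => w.length = t.length := by
  induction t with
  | ih1 i => exact (toT_gen i).symm ▸ mon_mem_supp (by simp [FreeMagma.length])
  | ih2 t u ht hu =>
    change toT ⁅bracketing t, bracketing u⁆ ∈ _
    rw [toT_lie]
    refine sub_mem (mul_mem_supp ?_ ht hu) (mul_mem_supp ?_ hu ht)
    · intro a b ha hb
      simp_all [FreeMagma.length]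
    · intro a b ha hb
      simp_all [FreeMagma.length, add_comm]

theorem toT_homogeneous {n : ℕ} {x : L} (hx : x ∈ homogeneous n) :
    toT x ∈ supp fun w => w.length = n := by
  have : homogeneous n ≤ (supp fun w => w.length = n).comap toT.toLinearMap := by
    refine Submodule.span_le.2 ?_
    rintro _ ⟨t, ht, rfl⟩
    have := toT_bracketing t
    have ht' : t.length = n := ht
    rwa [ht'] at this
  exact this hx

theorem lie_gen_homogeneous {n : ℕ} {x : L} (i : Fin 3) (hx : x ∈ homogeneous n) :
    ⁅gen i, x⁆ ∈ homogeneous (n + 1) := by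
  have : homogeneous n ≤ (homogeneous (n + 1)).comap (LieAlgebra.ad ℂ L (gen i)) := by
    refine Submodule.span_le.2 ?_
    rintro _ ⟨t, ht, rfl⟩
    refine Submodule.subset_span ⟨.mul (.of i) t, ?_, rfl⟩
    have : t.length = n := ht
    simp [FreeMagma.length, this, add_comm]
  exact this hx

theorem rightBracket_homogeneous (w : List (Fin 3)) : rightBracket w ∈ homogeneous w.length := by
  induction w with
  | nil => exact zero_mem _
  | cons i w ih =>
    cases w with
    | nil => exact Submodule.subset_span ⟨.of i, rfl, rfl⟩
    | cons j w => exact lie_gen_homogeneous i ih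

theorem euler_bracketing (t : FreeMagma (Fin 3)) :
    euler (bracketing t) = (t.length : ℂ) • bracketing t := by
  induction t with
  | ih1 i =>
    change euler (gen i) = _
    simp [FreeMagma.length, bracketing]
  | ih2 t u ht hu =>
    change euler ⁅bracketing t, bracketing u⁆ = ((t.length + u.length : ℕ) : ℂ) • ⁅_, _⁆
    rw [LieDerivation.apply_lie_eq_add, ht, hu, lie_smul, smul_lie, Nat.cast_add, add_smul,
      add_comm]

theorem euler_homogeneous {n : ℕ} {x : L} (hx : x ∈ homogeneous n) : euler x = (n : ℂ) • x := by
  induction hx using Submodule.span_induction with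
  | zero => simp
  | add x y _ _ hx hy => rw [map_add, hx, hy, smul_add]
  | smul r x _ hx => rw [map_smul, hx, smul_comm]
  | mem x hx =>
    obtain ⟨t, ht, rfl⟩ := hx
    have ht' : t.length = n := ht
    rw [euler_bracketing, ht']

theorem homogeneous_zero : homogeneous 0 = ⊥ := by
  rw [homogeneous, Submodule.span_eq_bot]
  rintro _ ⟨t, ht, rfl⟩
  exact absurd ht (FreeMagma.length_pos t).ne'

/-- In positive degree, an element is recovered from its image in the free associative algebra:
applying the Dynkin operator multiplies it by its degree. -/
theorem eq_zero_of_toT_eq_zero {n : ℕ} {x : L} (hx : x ∈ homogeneous n) (h : toT x = 0) :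
    x = 0 := by
  rcases Nat.eq_zero_or_pos n with rfl | hn
  · rw [homogeneous_zero] at hx
    exact (Submodule.mem_bot ℂ).1 hx
  · have h1 := dynkin_toT x
    rw [h, map_zero, euler_homogeneous hx] at h1
    exact (smul_eq_zero.1 h1.symm).resolve_left (by exact_mod_cast hn.ne')

/-! ### Matrix units acting on the free Lie algebra -/

/-- The derivation by which the matrix unit `E i j` acts: `e_j ↦ e_i`. -/
def unitAct (i j : Fin 3) : LieDerivation ℂ L L := derivation fun k => if k = j then gen i else 0

theorem unitAct_gen (i j k : Fin 3) : unitAct i j (gen k) = if k = j then gen i else 0 :=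
  derivation_of _ _

theorem unitAct_comm (i j k l : Fin 3) (x : L) :
    unitAct i j (unitAct k l x) = unitAct k l (unitAct i j x) +
      (if j = k then unitAct i l x else 0) - (if l = i then unitAct k j x else 0) := by
  have h : ⁅unitAct i j, unitAct k l⁆ =
      (if j = k then unitAct i l else 0) - (if l = i then unitAct k j else 0) := by
    refine derivation_ext fun m => ?_
    rw [LieDerivation.lie_apply, unitAct_gen, unitAct_gen, LieDerivation.sub_apply]
    by_cases h1 : j = k <;> by_cases h2 : l = i <;> by_cases h3 : m = l <;> by_cases h4 : m = j <;>
      subst_vars <;> simp_all [unitAct_gen, eq_comm]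
  have hx := congrArg (fun D : LieDerivation ℂ L L => D x) h
  simp only [LieDerivation.lie_apply, LieDerivation.sub_apply] at hx
  rw [sub_eq_iff_eq_add] at hx
  rw [hx]
  split_ifs <;> (try simp only [LieDerivation.coe_zero, Pi.zero_apply]) <;> abel

theorem naturalAction_eq (A : LieAlgebra.SpecialLinear.sl (Fin 3) ℂ) (x : L) :
    naturalAction A x = ∑ i, ∑ j, A.val i j • unitAct i j x := by
  have h : naturalAction A = ∑ i, ∑ j, A.val i j • unitAct i j := by
    refine derivation_ext fun m => ?_
    change derivation _ (gen m) = _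
    rw [derivation_of]
    fin_cases m <;> simp [Fin.sum_univ_three, unitAct_gen]
  rw [h]
  simp [Fin.sum_univ_three]

theorem euler_eq (x : L) : euler x = unitAct 0 0 x + unitAct 1 1 x + unitAct 2 2 x := by
  have h : euler = unitAct 0 0 + unitAct 1 1 + unitAct 2 2 := by
    refine derivation_ext fun m => ?_
    rw [euler_gen]
    fin_cases m <;> simp [unitAct_gen]
  rw [h]
  rfl

/-- Invariance in terms of matrix units. -/
theorem mem_invariants_iff (x : L) : x ∈ invariants ↔
    (∀ i j, i ≠ j → unitAct i j x = 0) ∧ unitAct 0 0 x = unitAct 1 1 x ∧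
      unitAct 1 1 x = unitAct 2 2 x := by
  constructor
  · intro h
    have h' : ∀ A : LieAlgebra.SpecialLinear.sl (Fin 3) ℂ, naturalAction A x = 0 := h
    have key : ∀ A : Matrix (Fin 3) (Fin 3) ℂ, A.trace = 0 →
        ∑ i, ∑ j, A i j • unitAct i j x = 0 := fun A hA => by
      have := h' ⟨A, hA⟩
      rwa [naturalAction_eq] at this
    refine ⟨fun i j hij => ?_, ?_, ?_⟩
    · have := key (Matrix.single i j 1) (by simp [Matrix.trace_single_eq_of_ne, hij])
      fin_cases i <;> fin_cases j <;>
        first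
        | exact absurd rfl hij
        | simpa [Fin.sum_univ_three, Matrix.single_apply] using this
    · have := key (Matrix.diagonal ![1, -1, 0]) (by simp [Matrix.trace, Fin.sum_univ_three])
      simpa [Fin.sum_univ_three, Matrix.diagonal_apply, add_neg_eq_zero] using this
    · have := key (Matrix.diagonal ![0, 1, -1]) (by simp [Matrix.trace, Fin.sum_univ_three])
      simpa [Fin.sum_univ_three, Matrix.diagonal_apply, add_neg_eq_zero] using this
  · rintro ⟨h, h1, h2⟩ A
    have hA : A.val 0 0 + A.val 1 1 + A.val 2 2 = 0 := by
      have : Matrix.trace A.val = 0 := A.2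
      simpa [Matrix.trace, Fin.sum_univ_three] using this
    rw [naturalAction_eq]
    simp only [Fin.sum_univ_three]
    rw [h 0 1 (by decide), h 0 2 (by decide), h 1 0 (by decide), h 1 2 (by decide),
      h 2 0 (by decide), h 2 1 (by decide), h1, h2]
    simp only [smul_zero, add_zero, zero_add]
    rw [← add_smul, ← add_smul, hA, zero_smul]

/-- The weight space of `L` on which the diagonal matrix units act by `a`, `b`, `c`. -/
def weightSpace (a b c : ℤ) : Submodule ℂ L where
  carrier := {x | unitAct 0 0 x = (a : ℂ) • x ∧ unitAct 1 1 x = (b : ℂ) • x ∧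
    unitAct 2 2 x = (c : ℂ) • x}
  add_mem' {x y} hx hy := by
    refine ⟨?_, ?_, ?_⟩
    · rw [map_add, hx.1, hy.1, smul_add]
    · rw [map_add, hx.2.1, hy.2.1, smul_add]
    · rw [map_add, hx.2.2, hy.2.2, smul_add]
  zero_mem' := by simp
  smul_mem' r x hx := by
    refine ⟨?_, ?_, ?_⟩
    · rw [map_smul, hx.1, smul_comm]
    · rw [map_smul, hx.2.1, smul_comm]
    · rw [map_smul, hx.2.2, smul_comm]

theorem euler_weightSpace {a b c : ℤ} {x : L} (hx : x ∈ weightSpace a b c) :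
    euler x = ((a + b + c : ℤ) : ℂ) • x := by
  rw [euler_eq, hx.1, hx.2.1, hx.2.2]
  push_cast
  simp only [add_smul]

theorem unitAct_weightSpace (i j : Fin 3) {a b c : ℤ} {x : L} (hx : x ∈ weightSpace a b c) :
    unitAct i j x ∈ weightSpace (a + (if i = 0 then 1 else 0) - (if j = 0 then 1 else 0))
      (b + (if i = 1 then 1 else 0) - (if j = 1 then 1 else 0))
      (c + (if i = 2 then 1 else 0) - (if j = 2 then 1 else 0)) := by
  obtain ⟨h0, h1, h2⟩ := hx
  refine ⟨?_, ?_, ?_⟩ <;> rw [unitAct_comm] <;> simp only [h0, h1, h2, map_smul] <;>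
    fin_cases i <;> fin_cases j <;> simp [h0, h1, h2] <;> module

/-! ### Matrix units acting on words -/

/-- The image of a word under the matrix unit `E i j`: the sum of the words obtained by replacing
one letter `j` by `i`. -/
def wordAct (i j : Fin 3) : List (Fin 3) → T
  | [] => 0
  | y :: w => (if y = j then mon (i :: w) else 0) + mon [y] * wordAct i j w

/-- The action of the matrix unit `E i j` on the free associative algebra. -/
def actT (i j : Fin 3) : T →ₗ[ℂ] T := wordExt (wordAct i j)

theorem actT_mon (i j : Fin 3) (w : List (Fin 3)) : actT i j (mon w) = wordAct i j w :=
  wordExt_mon _ _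

theorem wordAct_append (i j : Fin 3) (u v : List (Fin 3)) :
    wordAct i j (u ++ v) = wordAct i j u * mon v + mon u * wordAct i j v := by
  induction u with
  | nil => simp [wordAct, mon_nil]
  | cons y u ih =>
    rw [List.cons_append, wordAct, wordAct, ih, mon_cons y u]
    split_ifs
    · rw [← List.cons_append, mon_append]
      noncomm_ring
    · noncomm_ring

theorem actT_mul (i j : Fin 3) (F G : T) :
    actT i j (F * G) = actT i j F * G + F * actT i j G := by
  have h : (LinearMap.mul ℂ T).compr₂ (actT i j) =
      (LinearMap.mul ℂ T).comp (actT i j) + (LinearMap.mul ℂ T).compl₂ (actT i j) :=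
    ext_mon fun u => ext_mon fun v => by
      simp [← mon_append, actT_mon, wordAct_append]
  exact LinearMap.congr_fun₂ h F G

theorem toT_unitAct (i j : Fin 3) (x : L) : toT (unitAct i j x) = actT i j (toT x) := by
  induction x using free_induction with
  | of k =>
    rw [unitAct_gen, toT_gen, actT_mon]
    split_ifs with h <;> simp [wordAct, h]
  | add x y hx hy => simp only [map_add, hx, hy]
  | smul r x hx => simp only [map_smul, hx]
  | lie x y hx hy =>
    rw [LieDerivation.apply_lie_eq_add, map_add, toT_lie, toT_lie, toT_lie, map_sub, actT_mul,
      actT_mul, hx, hy]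
    abel

theorem co_actT_diag (i : Fin 3) (w : List (Fin 3)) (F : T) :
    co w (actT i i F) = (w.count i : ℂ) * co w F := by
  have key : ∀ u : List (Fin 3), wordAct i i u = (u.count i : ℂ) • mon u := fun u => by
    induction u with
    | nil => simp [wordAct]
    | cons y u ih =>
      rw [wordAct, ih, mul_smul_comm, ← mon_cons, List.count_cons]
      by_cases h : y = i
      · subst h
        simp [add_smul, add_comm]
      · simp [h]
  have h : (co w).comp (actT i i) = (w.count i : ℂ) • co w := ext_mon fun u => by
    simp only [LinearMap.comp_apply, actT_mon, key, map_smul, LinearMap.smul_apply, co_mon,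
      smul_eq_mul]
    split_ifs with h
    · rw [h]
    · simp
  exact LinearMap.congr_fun h F

theorem toT_weightSpace {a b c : ℤ} {x : L} (hx : x ∈ weightSpace a b c) :
    toT x ∈ supp fun w => (w.count 0 : ℤ) = a ∧ (w.count 1 : ℤ) = b ∧ (w.count 2 : ℤ) = c := by
  intro w hw
  have key : ∀ (i : Fin 3) (r : ℤ), unitAct i i x = (r : ℂ) • x → (w.count i : ℤ) = r := by
    intro i r h
    have h1 := co_actT_diag i w (toT x)
    rw [← toT_unitAct, h, map_smul, map_smul, smul_eq_mul] at h1
    exact_mod_cast (mul_right_cancel₀ hw h1).symm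
  exact ⟨key 0 a hx.1, key 1 b hx.2.1, key 2 c hx.2.2⟩

theorem weightSpace_eq_zero {a b c : ℤ} (h : a + b + c ≠ 0) {x : L} (hx : x ∈ weightSpace a b c)
    (h0 : toT x = 0) : x = 0 := by
  have h1 := dynkin_toT x
  rw [h0, map_zero, euler_weightSpace hx] at h1
  exact (smul_eq_zero.1 h1.symm).resolve_left (by exact_mod_cast h)

/-! ### Positivity -/

/-- `E j i` is the transpose of `E i j` with respect to the basis of words, and its matrix
coefficients are real. -/
theorem co_wordAct_transpose (i j : Fin 3) (u v : List (Fin 3)) :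
    co u (wordAct i j v) = star (co v (wordAct j i u)) := by
  induction v generalizing u with
  | nil =>
    cases u with
    | nil => simp [wordAct]
    | cons x u => 
      simp only [wordAct, map_zero, map_add, co_mul_nil, apply_ite (co []), co_mon]
      simp
  | cons y v ih =>
    cases u with
    | nil =>
      simp only [wordAct, map_zero, map_add, co_mul_nil, apply_ite (co []), co_mon]
      simp
    | cons x u =>
      simp only [wordAct, map_zero, map_add, co_mul_cons, apply_ite (co (x :: u)),
        apply_ite (co (y :: v)), co_mon, ih u, List.cons.injEq]
      by_cases h1 : x = y <;> by_cases h2 : y = j <;> by_cases h3 : i = x <;> by_cases h4 : u = v <;>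
        simp_all [eq_comm]

/-- The Hermitian form on the free associative algebra for which the words are orthonormal. -/
def form (F : T) : T →ₗ[ℂ] ℂ := wordExt fun w => star (co w F)

theorem form_add (F G K : T) : form (F + G) K = form F K + form G K := by
  have : form (F + G) = form F + form G := ext_mon fun w => by simp [form]
  rw [this]
  rfl

theorem form_smul (r : ℂ) (F K : T) : form (r • F) K = star r * form F K := by
  have : form (r • F) = star r • form F := ext_mon fun w => by simp [form]
  rw [this]
  rfl

theorem form_mon (u : List (Fin 3)) (K : T) : form (mon u) K = co u K := by
  have : form (mon u) = co u := ext_mon fun w => by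
    simp only [form, wordExt_mon, co_mon]
    by_cases h : u = w <;> simp [h, eq_comm]
  rw [this]

theorem form_actT (i j : Fin 3) (F G : T) : form (actT i j F) G = form F (actT j i G) := by
  obtain ⟨s, hs⟩ := eq_finsum_co F
  rw [hs]
  clear hs
  classical
  induction s using Finset.induction_on with
  | empty =>
    have h : form 0 = 0 := ext_mon fun w => by simp [form]
    simp [h]
  | insert w s hw ih =>
    rw [Finset.sum_insert hw, map_add, form_add, form_add, ih, map_smul, form_smul, form_smul,
      form_mon, actT_mon]
    congr 2
    have : form (wordAct i j w) = (co w).comp (actT j i) := ext_mon fun u => by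
      simp only [form, wordExt_mon, LinearMap.comp_apply, actT_mon]
      exact (co_wordAct_transpose j i w u).symm
    rw [this]
    rfl

theorem form_self (F : T) : ∃ r : ℝ, 0 ≤ r ∧ form F F = r ∧ (r = 0 → F = 0) := by
  obtain ⟨s, hs⟩ := eq_finsum_co F
  refine ⟨∑ w ∈ s, Complex.normSq (co w F),
    Finset.sum_nonneg fun w _ => Complex.normSq_nonneg _, ?_, fun h => ?_⟩
  · have : form F F = form F (∑ w ∈ s, co w F • mon w) := by rw [← hs]
    rw [this, map_sum]
    push_cast
    refine Finset.sum_congr rfl fun w _ => ?_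
    rw [map_smul, form, wordExt_mon, smul_eq_mul]
    exact Complex.mul_conj _
  · rw [Finset.sum_eq_zero_iff_of_nonneg fun w _ => Complex.normSq_nonneg _] at h
    rw [hs]
    refine Finset.sum_eq_zero fun w hw => ?_
    rw [Complex.normSq_eq_zero.1 (h w hw), zero_smul]

/-- A sum of operators `E j i E i j` and a nonnegative scalar vanishes only where each term does. -/
theorem actT_eq_zero (s : Finset (Fin 3 × Fin 3)) (c : ℝ) (hc : 0 ≤ c) (F : T)
    (h : ∑ p ∈ s, actT p.2 p.1 (actT p.1 p.2 F) + (c : ℂ) • F = 0) :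
    (∀ p ∈ s, actT p.1 p.2 F = 0) ∧ (c ≠ 0 → F = 0) := by
  -- Pairing with `F` gives `∑ ‖E i j F‖ ^ 2 + c ‖F‖ ^ 2 = 0`.
  choose r hr0 hr hr1 using form_self
  have h1 : ∑ p ∈ s, r (actT p.1 p.2 F) + c * r F = 0 := by
    have h2 := congrArg (form F) h
    rw [map_add, map_sum, map_zero, map_smul, hr, smul_eq_mul] at h2
    simp only [← form_actT, hr] at h2
    exact_mod_cast h2
  rw [add_eq_zero_iff_of_nonneg (Finset.sum_nonneg fun p _ => hr0 _) (mul_nonneg hc (hr0 F)),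
    Finset.sum_eq_zero_iff_of_nonneg fun p _ => hr0 _] at h1
  exact ⟨fun p hp => hr1 _ (h1.1 p hp),
    fun h => hr1 _ ((mul_eq_zero.1 h1.2).resolve_left h)⟩

/-- The counterpart of `actT_eq_zero` in the free Lie algebra. -/
theorem unitAct_eq_zero {a b d : ℤ} (hn : a + b + d ≠ 0) {x : L} (hx : x ∈ weightSpace a b d)
    (s : Finset (Fin 3 × Fin 3)) (c : ℝ) (hc : 0 ≤ c)
    (h : ∑ p ∈ s, unitAct p.2 p.1 (unitAct p.1 p.2 x) + (c : ℂ) • x = 0) :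
    (∀ p ∈ s, unitAct p.1 p.2 x = 0) ∧ (c ≠ 0 → x = 0) := by
  have h1 := congrArg toT h
  simp only [map_add, map_sum, map_smul, map_zero, toT_unitAct] at h1
  obtain ⟨h2, h3⟩ := actT_eq_zero s c hc _ h1
  refine ⟨fun p hp => weightSpace_eq_zero ?_ (unitAct_weightSpace p.1 p.2 hx)
    ((toT_unitAct _ _ _).trans (h2 p hp)), fun h => weightSpace_eq_zero hn hx (h3 h)⟩
  obtain ⟨i, j⟩ := p
  fin_cases i <;> fin_cases j <;> simp <;> omega

/-! ### The Dirac operator -/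

/-- The operator `∑ f e` over the positive roots. Up to a scalar on each weight space it is half the
Casimir operator. -/
def lowerRaise (x : L) : L :=
  unitAct 1 0 (unitAct 0 1 x) + unitAct 2 1 (unitAct 1 2 x) + unitAct 2 0 (unitAct 0 2 x)

/-- The first component of the Dirac operator. An even element of `L ⊗ Λ(𝔫*)` is written as
`x + p e₁* ∧ e₂* + q e₁* ∧ e₃* + r e₂* ∧ e₃*`, where `e₁ = E 0 1`, `e₂ = E 1 2` and
`e₃ = [e₁, e₂] = E 0 2` span `𝔫`, and an odd one as `y e₁* + z e₂* + w e₃* + v e₁* ∧ e₂* ∧ e₃*`. This is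
the component `y` of the image under `d + d*`, with `d` the Chevalley–Eilenberg differential and `d*`
its adjoint; `dirac₂`, `dirac₃`, `dirac₄` are the components `z`, `w`, `v`. -/
def dirac₁ (x p q : L) : L := unitAct 0 1 x - unitAct 2 1 p - unitAct 2 0 q
/-- The component `z` of the Dirac operator; see `dirac₁`. -/
def dirac₂ (x p r : L) : L := unitAct 1 2 x + unitAct 1 0 p - unitAct 2 0 r
/-- The component `w` of the Dirac operator; see `dirac₁`. -/
def dirac₃ (x p q r : L) : L := unitAct 0 2 x + unitAct 1 0 q + unitAct 2 1 r - p
/-- The component `v` of the Dirac operator; see `dirac₁`. -/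
def dirac₄ (p q r : L) : L := unitAct 0 1 r - unitAct 1 2 q + unitAct 0 2 p

/-- The component `x` of the Dirac operator from the odd to the even part; see `dirac₁`. -/
def codirac₁ (y z w : L) : L := unitAct 1 0 y + unitAct 2 1 z + unitAct 2 0 w
/-- The component `p` of the Dirac operator from the odd to the even part. -/
def codirac₂ (y z w v : L) : L := unitAct 0 1 z - unitAct 1 2 y - w + unitAct 2 0 v
/-- The component `q` of the Dirac operator from the odd to the even part. -/
def codirac₃ (y w v : L) : L := unitAct 0 1 w - unitAct 0 2 y - unitAct 2 1 v
/-- The component `r` of the Dirac operator from the odd to the even part. -/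
def codirac₄ (z w v : L) : L := unitAct 1 2 w - unitAct 0 2 z + unitAct 1 0 v

/-- Kostant's formula on the even part: the square of the Dirac operator is diagonal. The scalar on
the component of weight `λ` is `((λ, λ) + 2 (λ, ρ)) / 2`, the part of half the Casimir operator that
comes from the Cartan subalgebra. -/
theorem codirac_dirac {k : ℤ} {x p q r : L} (hp : p ∈ weightSpace (k + 1) k (k - 1))
    (hq : q ∈ weightSpace (k + 2) (k - 1) (k - 1)) (hr : r ∈ weightSpace (k + 1) (k + 1) (k - 2)) :
    codirac₁ (dirac₁ x p q) (dirac₂ x p r) (dirac₃ x p q r) = lowerRaise x ∧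
    codirac₂ (dirac₁ x p q) (dirac₂ x p r) (dirac₃ x p q r) (dirac₄ p q r) =
      lowerRaise p + (3 : ℂ) • p ∧
    codirac₃ (dirac₁ x p q) (dirac₃ x p q r) (dirac₄ p q r) = lowerRaise q + (6 : ℂ) • q ∧
    codirac₄ (dirac₂ x p r) (dirac₃ x p q r) (dirac₄ p q r) = lowerRaise r + (6 : ℂ) • r := by
  -- The instances of `c` move raising operators to the right and put each kind in a fixed order.
  have c := unitAct_comm
  refine ⟨?_, ?_, ?_, ?_⟩ <;>
  simp only [codirac₁, codirac₂, codirac₃, codirac₄, dirac₁, dirac₂, dirac₃, dirac₄, lowerRaise,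
    map_add, map_sub] <;>
  simp [c 0 1 1 0, c 0 1 2 1, c 0 1 2 0, c 1 2 1 0, c 1 2 2 1, c 1 2 2 0, c 0 2 1 0, c 0 2 2 1,
    c 0 2 2 0, c 1 2 0 1, c 0 2 0 1, c 0 2 1 2, c 2 1 1 0, c 2 0 1 0, c 2 0 2 1,
    hp.1, hp.2.1, hp.2.2, hq.1, hq.2.1, hq.2.2, hr.1, hr.2.1, hr.2.2] <;>
  module

/-- Kostant's formula on the odd part. -/
theorem dirac_codirac {k : ℤ} {y z w v : L} (hy : y ∈ weightSpace (k + 1) (k - 1) k)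
    (hz : z ∈ weightSpace k (k + 1) (k - 1)) (hw : w ∈ weightSpace (k + 1) k (k - 1))
    (hv : v ∈ weightSpace (k + 2) k (k - 2)) :
    dirac₁ (codirac₁ y z w) (codirac₂ y z w v) (codirac₃ y w v) = lowerRaise y + (2 : ℂ) • y ∧
    dirac₂ (codirac₁ y z w) (codirac₂ y z w v) (codirac₄ z w v) = lowerRaise z + (2 : ℂ) • z ∧
    dirac₃ (codirac₁ y z w) (codirac₂ y z w v) (codirac₃ y w v) (codirac₄ z w v) =
      lowerRaise w + (3 : ℂ) • w ∧
    dirac₄ (codirac₂ y z w v) (codirac₃ y w v) (codirac₄ z w v) = lowerRaise v + (8 : ℂ) • v := by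
  have c := unitAct_comm
  refine ⟨?_, ?_, ?_, ?_⟩ <;>
  simp only [codirac₁, codirac₂, codirac₃, codirac₄, dirac₁, dirac₂, dirac₃, dirac₄, lowerRaise,
    map_add, map_sub] <;>
  simp [c 0 1 1 0, c 0 1 2 1, c 0 1 2 0, c 1 2 1 0, c 1 2 2 1, c 1 2 2 0, c 0 2 1 0, c 0 2 2 1,
    c 0 2 2 0, c 1 2 0 1, c 0 2 0 1, c 0 2 1 2, c 2 1 1 0, c 2 0 1 0, c 2 0 2 1,
    hy.1, hy.2.1, hz.2.1, hz.2.2, hw.1, hw.2.2, hv.1, hv.2.1, hv.2.2] <;>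
  module

/-! ### Dimensions of weight spaces as traces -/

/-- The dimension of a space of homogeneous elements, as the trace of the Dynkin operator. -/
theorem finrank_eq_trace (S : Finset (List (Fin 3))) (W : Submodule ℂ L) (r : ℂ) (hr : r ≠ 0)
    (h1 : ∀ x ∈ W, toT x ∈ supp fun w => w ∈ S) (h2 : ∀ w ∈ S, rightBracket w ∈ W)
    (h3 : ∀ x ∈ W, euler x = r • x) :
    FiniteDimensional ℂ W ∧
      r * Module.finrank ℂ W = ∑ w ∈ S, co w (toT (rightBracket w)) := by
  classical
  let f : W →ₗ[ℂ] (S → ℂ) := LinearMap.pi fun w => (co w.1) ∘ₗ toT.toLinearMap ∘ₗ W.subtype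
  let g : (S → ℂ) →ₗ[ℂ] W := Fintype.linearCombination ℂ fun w : S => ⟨rightBracket w.1, h2 _ w.2⟩
  -- `g ∘ f` is the restriction of `dynkin ∘ toT`, hence `r`; the trace of `f ∘ g` is the same.
  have hgf : g ∘ₗ f = r • LinearMap.id := by
    ext x
    have hx : toT x.1 = ∑ w ∈ S, co w (toT x.1) • mon w := by
      apply ext_co
      intro u
      simp only [map_sum, map_smul, co_mon, smul_eq_mul, mul_ite, mul_one, mul_zero,
        Finset.sum_ite_eq']
      split_ifs with h
      · rfl
      · by_contra hne
        exact h (h1 x.1 x.2 u hne)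
    have h4 := dynkin_toT x.1
    rw [hx, map_sum, h3 _ x.2] at h4
    simp only [map_smul, dynkin_mon] at h4
    simp only [g, f, LinearMap.comp_apply, Fintype.linearCombination_apply, LinearMap.smul_apply,
      LinearMap.id_apply, Submodule.coe_smul, Submodule.coe_sum]
    rw [← h4, ← Finset.sum_coe_sort S]
    rfl
  have hinj : Function.Injective f := by
    intro x y hxy
    have h4 := congrArg g hxy
    rw [← LinearMap.comp_apply, ← LinearMap.comp_apply, hgf] at h4
    simpa [hr] using h4
  have hfin : FiniteDimensional ℂ W := FiniteDimensional.of_injective f hinj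
  refine ⟨hfin, ?_⟩
  have h5 := LinearMap.trace_comp_comm' f g
  rw [hgf, map_smul, LinearMap.trace_id, smul_eq_mul] at h5
  rw [h5, LinearMap.trace_eq_matrix_trace ℂ (Pi.basisFun ℂ S), Matrix.trace,
    ← Finset.sum_coe_sort S]
  refine Finset.sum_congr rfl fun w _ => ?_
  rw [Matrix.diag_apply, LinearMap.toMatrix_apply, Pi.basisFun_repr, Pi.basisFun_apply,
    LinearMap.comp_apply]
  simp only [g, Fintype.linearCombination_apply_single, one_smul]
  rfl

theorem weightSpace_lie {a b c a' b' c' : ℤ} {x y : L} (hx : x ∈ weightSpace a b c)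
    (hy : y ∈ weightSpace a' b' c') : ⁅x, y⁆ ∈ weightSpace (a + a') (b + b') (c + c') := by
  refine ⟨?_, ?_, ?_⟩ <;>
  simp only [LieDerivation.apply_lie_eq_add, hx.1, hx.2.1, hx.2.2, hy.1, hy.2.1, hy.2.2, lie_smul,
    smul_lie] <;>
  push_cast <;>
  module

theorem gen_weightSpace (i : Fin 3) : gen i ∈ weightSpace (if i = 0 then 1 else 0)
    (if i = 1 then 1 else 0) (if i = 2 then 1 else 0) := by
  refine ⟨?_, ?_, ?_⟩ <;> rw [unitAct_gen] <;> fin_cases i <;> simp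

theorem rightBracket_weightSpace (w : List (Fin 3)) :
    rightBracket w ∈ weightSpace (w.count 0) (w.count 1) (w.count 2) := by
  induction w with
  | nil => exact zero_mem _
  | cons i w ih =>
    cases w with
    | nil =>
      have h := gen_weightSpace i
      fin_cases i <;> simpa [rightBracket] using h
    | cons j w =>
      have h := weightSpace_lie (gen_weightSpace i) ih
      have e (m : Fin 3) : ((List.count m (i :: j :: w) : ℕ) : ℤ) =
          (if i = m then 1 else 0) + (List.count m (j :: w) : ℤ) := by
        rw [List.count_cons, Nat.cast_add, add_comm]
        simp only [beq_iff_eq, Nat.cast_ite, Nat.cast_one, Nat.cast_zero]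
      rw [e, e, e]
      exact h

/-- The words of length `n`. -/
def words : ℕ → Finset (List (Fin 3))
  | 0 => {[]}
  | n + 1 => (Finset.univ ×ˢ words n).image fun p => p.1 :: p.2

theorem sum_words_succ {M : Type*} [AddCommMonoid M] (n : ℕ) (g : List (Fin 3) → M) :
    ∑ w ∈ words (n + 1), g w = ∑ x, ∑ w ∈ words n, g (x :: w) := by
  rw [words, Finset.sum_image, Finset.sum_product]
  rintro ⟨x, u⟩ _ ⟨y, v⟩ _ h
  simpa using h

theorem mem_words {n : ℕ} {w : List (Fin 3)} : w ∈ words n ↔ w.length = n := by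
  induction n generalizing w with
  | zero => simp [words]
  | succ n ih =>
    cases w with
    | nil => simp [words]
    | cons x w => simp [words, ih]

theorem length_eq_count (w : List (Fin 3)) : w.length = w.count 0 + w.count 1 + w.count 2 := by
  induction w with
  | nil => rfl
  | cons x w ih =>
    rw [List.length_cons, ih]
    fin_cases x <;> simp <;> omega

/-- The words with prescribed numbers of letters. -/
def contentWords (n : ℕ) (a b c : ℤ) : Finset (List (Fin 3)) :=
  (words n).filter fun w => (w.count 0 : ℤ) = a ∧ (w.count 1 : ℤ) = b ∧ (w.count 2 : ℤ) = c

theorem weightSpace_trace {n : ℕ} {a b c : ℤ} (hn : n ≠ 0) (h : a + b + c = n) :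
    FiniteDimensional ℂ (weightSpace a b c) ∧ (n : ℂ) * Module.finrank ℂ (weightSpace a b c) =
      ∑ w ∈ contentWords n a b c, co w (toT (rightBracket w)) := by
  refine finrank_eq_trace _ _ n (by exact_mod_cast hn) (fun x hx w hw => ?_) (fun w hw => ?_)
    fun x hx => ?_
  · have hw' := toT_weightSpace hx w hw
    refine Finset.mem_filter.2 ⟨mem_words.2 ?_, hw'⟩
    have := length_eq_count w
    omega
  · obtain ⟨_, h0, h1, h2⟩ := Finset.mem_filter.1 hw
    have := rightBracket_weightSpace w
    rwa [h0, h1, h2] at this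
  · rw [euler_weightSpace hx, h]
    norm_cast

theorem weightSpace_finite {a b c : ℤ} (h : 0 < a + b + c) :
    FiniteDimensional ℂ (weightSpace a b c) :=
  (weightSpace_trace (n := (a + b + c).toNat) (by omega) (by omega)).1

theorem unitAct_mem (i j : Fin 3) {a b c a' b' c' : ℤ} {x : L} (hx : x ∈ weightSpace a b c)
    (h0 : a + (if i = 0 then 1 else 0) - (if j = 0 then 1 else 0) = a' := by simp +decide <;> omega)
    (h1 : b + (if i = 1 then 1 else 0) - (if j = 1 then 1 else 0) = b' := by simp +decide <;> omega)
    (h2 : c + (if i = 2 then 1 else 0) - (if j = 2 then 1 else 0) = c' := by simp +decide <;> omega) :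
    unitAct i j x ∈ weightSpace a' b' c' := by
  subst h0 h1 h2
  exact unitAct_weightSpace i j hx

/-- The Dirac operator from the even to the odd part of `L ⊗ Λ(𝔫*)`, in total weight `(k, k, k)`:
the coefficient of `e*` lies in the weight space shifted by the root of `e`. -/
def dirac (k : ℤ) :
    (weightSpace k k k × weightSpace (k + 1) k (k - 1) ×
      weightSpace (k + 2) (k - 1) (k - 1) × weightSpace (k + 1) (k + 1) (k - 2)) →ₗ[ℂ]
    (weightSpace (k + 1) (k - 1) k × weightSpace k (k + 1) (k - 1) ×
      weightSpace (k + 1) k (k - 1) × weightSpace (k + 2) k (k - 2)) where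
  toFun u := (
    ⟨dirac₁ u.1 u.2.1 u.2.2.1, sub_mem (sub_mem (unitAct_mem 0 1 u.1.2)
      (unitAct_mem 2 1 u.2.1.2)) (unitAct_mem 2 0 u.2.2.1.2)⟩,
    ⟨dirac₂ u.1 u.2.1 u.2.2.2, sub_mem (add_mem (unitAct_mem 1 2 u.1.2)
      (unitAct_mem 1 0 u.2.1.2)) (unitAct_mem 2 0 u.2.2.2.2)⟩,
    ⟨dirac₃ u.1 u.2.1 u.2.2.1 u.2.2.2, sub_mem (add_mem (add_mem (unitAct_mem 0 2 u.1.2)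
      (unitAct_mem 1 0 u.2.2.1.2)) (unitAct_mem 2 1 u.2.2.2.2)) u.2.1.2⟩,
    ⟨dirac₄ u.2.1 u.2.2.1 u.2.2.2, add_mem (sub_mem (unitAct_mem 0 1 u.2.2.2.2)
      (unitAct_mem 1 2 u.2.2.1.2)) (unitAct_mem 0 2 u.2.1.2)⟩)
  map_add' u v := by
    simp only [dirac₁, dirac₂, dirac₃, dirac₄, Prod.ext_iff, Subtype.ext_iff, Prod.fst_add,
      Prod.snd_add, Submodule.coe_add, map_add]
    refine ⟨?_, ?_, ?_, ?_⟩ <;> abel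
  map_smul' s u := by
    simp only [dirac₁, dirac₂, dirac₃, dirac₄, Prod.ext_iff, Subtype.ext_iff, Prod.smul_fst,
      Prod.smul_snd, Submodule.coe_smul, map_smul, RingHom.id_apply, smul_sub, smul_add]
    simp

/-- The Dirac operator from the odd to the even part, in total weight `(k, k, k)`. -/
def codirac (k : ℤ) :
    (weightSpace (k + 1) (k - 1) k × weightSpace k (k + 1) (k - 1) ×
      weightSpace (k + 1) k (k - 1) × weightSpace (k + 2) k (k - 2)) →ₗ[ℂ]
    (weightSpace k k k × weightSpace (k + 1) k (k - 1) ×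
      weightSpace (k + 2) (k - 1) (k - 1) × weightSpace (k + 1) (k + 1) (k - 2)) where
  toFun u := (
    ⟨codirac₁ u.1 u.2.1 u.2.2.1, add_mem (add_mem (unitAct_mem 1 0 u.1.2)
      (unitAct_mem 2 1 u.2.1.2)) (unitAct_mem 2 0 u.2.2.1.2)⟩,
    ⟨codirac₂ u.1 u.2.1 u.2.2.1 u.2.2.2, add_mem (sub_mem (sub_mem (unitAct_mem 0 1 u.2.1.2)
      (unitAct_mem 1 2 u.1.2)) u.2.2.1.2) (unitAct_mem 2 0 u.2.2.2.2)⟩,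
    ⟨codirac₃ u.1 u.2.2.1 u.2.2.2, sub_mem (sub_mem (unitAct_mem 0 1 u.2.2.1.2)
      (unitAct_mem 0 2 u.1.2)) (unitAct_mem 2 1 u.2.2.2.2)⟩,
    ⟨codirac₄ u.2.1 u.2.2.1 u.2.2.2, add_mem (sub_mem (unitAct_mem 1 2 u.2.2.1.2)
      (unitAct_mem 0 2 u.2.1.2)) (unitAct_mem 1 0 u.2.2.2.2)⟩)
  map_add' u v := by
    simp only [codirac₁, codirac₂, codirac₃, codirac₄, Prod.ext_iff, Subtype.ext_iff, Prod.fst_add,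
      Prod.snd_add, Submodule.coe_add, map_add]
    refine ⟨?_, ?_, ?_, ?_⟩ <;> abel
  map_smul' s u := by
    simp only [codirac₁, codirac₂, codirac₃, codirac₄, Prod.ext_iff, Subtype.ext_iff,
      Prod.smul_fst, Prod.smul_snd, Submodule.coe_smul, map_smul, RingHom.id_apply, smul_sub,
      smul_add]
    simp

/-- Positivity of the Casimir operator, in the form in which it meets Kostant's formula. -/
theorem lowerRaise_eq_zero {a b d : ℤ} (hn : a + b + d ≠ 0) {x : L} (hx : x ∈ weightSpace a b d)
    (c : ℝ) (hc : 0 ≤ c) (h : lowerRaise x + (c : ℂ) • x = 0) :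
    (unitAct 0 1 x = 0 ∧ unitAct 1 2 x = 0 ∧ unitAct 0 2 x = 0) ∧ (c ≠ 0 → x = 0) := by
  have h1 := unitAct_eq_zero hn hx {(0, 1), (1, 2), (0, 2)} c hc (by
    rw [← h, lowerRaise]
    simp [add_assoc])
  exact ⟨⟨h1.1 (0, 1) (by simp), h1.1 (1, 2) (by simp), h1.1 (0, 2) (by simp)⟩, h1.2⟩

theorem dirac_surjective {k : ℤ} (hk : 0 < k) : Function.Surjective (dirac k) := by
  have := weightSpace_finite (a := k + 1) (b := k - 1) (c := k) (by omega)
  have := weightSpace_finite (a := k) (b := k + 1) (c := k - 1) (by omega)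
  have := weightSpace_finite (a := k + 1) (b := k) (c := k - 1) (by omega)
  have := weightSpace_finite (a := k + 2) (b := k) (c := k - 2) (by omega)
  have h : Function.Injective (dirac k ∘ₗ codirac k) := by
    rw [← LinearMap.ker_eq_bot, LinearMap.ker_eq_bot']
    rintro ⟨y, z, w, v⟩ e
    -- By Kostant's formula each component is killed by `lowerRaise` plus a positive scalar.
    obtain ⟨h1, h2, h3, h4⟩ := dirac_codirac y.2 z.2 w.2 v.2
    simp only [dirac, codirac, LinearMap.comp_apply, LinearMap.coe_mk, AddHom.coe_mk, Prod.ext_iff,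
      Subtype.ext_iff, Prod.fst_zero, Prod.snd_zero, Submodule.coe_zero, h1, h2, h3, h4] at e
    obtain ⟨e1, e2, e3, e4⟩ := e
    have p1 := (lowerRaise_eq_zero (by omega) y.2 2 (by norm_num) (by exact_mod_cast e1)).2
      (by norm_num)
    have p2 := (lowerRaise_eq_zero (by omega) z.2 2 (by norm_num) (by exact_mod_cast e2)).2
      (by norm_num)
    have p3 := (lowerRaise_eq_zero (by omega) w.2 3 (by norm_num) (by exact_mod_cast e3)).2
      (by norm_num)
    have p4 := (lowerRaise_eq_zero (by omega) v.2 8 (by norm_num) (by exact_mod_cast e4)).2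
      (by norm_num)
    simp only [Prod.ext_iff, Subtype.ext_iff]
    exact ⟨p1, p2, p3, p4⟩
  have h' := LinearMap.surjective_of_injective h
  exact Function.Surjective.of_comp h'

/-- The kernel of the Dirac operator consists of the invariants. -/
theorem dirac_eq_zero_iff {k : ℤ} (hk : k ≠ 0) (u : weightSpace k k k ×
      weightSpace (k + 1) k (k - 1) × weightSpace (k + 2) (k - 1) (k - 1) ×
      weightSpace (k + 1) (k + 1) (k - 2)) :
    dirac k u = 0 ↔ u.1.1 ∈ invariants ∧ u.2 = 0 := by
  obtain ⟨⟨x, hx⟩, p, q, r⟩ := u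
  constructor
  · intro h
    obtain ⟨h1, h2, h3, h4⟩ := codirac_dirac (x := x) p.2 q.2 r.2
    have e := LinearMap.congr_arg (f := codirac k) h
    rw [map_zero] at e
    simp only [dirac, codirac, LinearMap.coe_mk, AddHom.coe_mk, Prod.ext_iff, Subtype.ext_iff,
      Prod.fst_zero, Prod.snd_zero, Submodule.coe_zero, h1, h2, h3, h4] at e
    obtain ⟨e1, e2, e3, e4⟩ := e
    have p1 := (lowerRaise_eq_zero (by omega) hx 0 le_rfl (by simpa using e1)).1
    have p2 := (lowerRaise_eq_zero (by omega) p.2 3 (by norm_num) (by exact_mod_cast e2)).2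
      (by norm_num)
    have p3 := (lowerRaise_eq_zero (by omega) q.2 6 (by norm_num) (by exact_mod_cast e3)).2
      (by norm_num)
    have p4 := (lowerRaise_eq_zero (by omega) r.2 6 (by norm_num) (by exact_mod_cast e4)).2
      (by norm_num)
    refine ⟨?_, ?_⟩
    · -- On the zero weight space raising and lowering operators commute, so `∑ e f` vanishes too.
      have p5 := (unitAct_eq_zero (by omega) hx {(1, 0), (2, 1), (2, 0)} 0 le_rfl (by
        simp [unitAct_comm 0 1 1 0, unitAct_comm 1 2 2 1, unitAct_comm 0 2 2 0, p1, hx.1, hx.2.1,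
          hx.2.2])).1
      rw [mem_invariants_iff]
      refine ⟨fun i j hij => ?_, hx.1.trans hx.2.1.symm, hx.2.1.trans hx.2.2.symm⟩
      fin_cases i <;> fin_cases j <;>
        first
        | exact absurd rfl hij
        | exact p1.1
        | exact p1.2.1
        | exact p1.2.2
        | exact p5 (1, 0) (by simp)
        | exact p5 (2, 1) (by simp)
        | exact p5 (2, 0) (by simp)
    · simp only [Prod.ext_iff, Subtype.ext_iff]
      exact ⟨p2, p3, p4⟩
  · rintro ⟨h, h'⟩
    have hp : p = 0 := congrArg (·.1) h'
    have hq : q = 0 := congrArg (·.2.1) h'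
    have hr : r = 0 := congrArg (·.2.2) h'
    subst hp hq hr
    have h1 := ((mem_invariants_iff x).1 h).1
    simp [dirac, dirac₁, dirac₂, dirac₃, dirac₄, h1 0 1, h1 1 2, h1 0 2]

/-- The invariants of degree `3 k` are the invariants of weight `(k, k, k)`. -/
theorem invariantsOfDegree_eq (k : ℕ) (hk : k ≠ 0) :
    invariantsOfDegree (3 * k) = invariants.toSubmodule ⊓ weightSpace k k k := by
  ext x
  refine and_congr_right fun hx => ⟨fun h => ?_, fun h => ?_⟩
  · obtain ⟨-, h1, h2⟩ := (mem_invariants_iff x).1 hx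
    have h3 := euler_homogeneous h
    rw [euler_eq, h1, h2] at h3
    have h4 : unitAct 2 2 x = (k : ℂ) • x := by
      have : (3 : ℂ) • unitAct 2 2 x = (3 : ℂ) • ((k : ℂ) • x) := by
        rw [smul_smul]
        push_cast at h3
        rw [← h3]
        module
      exact smul_right_injective L (three_ne_zero) this
    refine ⟨?_, ?_, ?_⟩
    · simpa [h1, h2] using h4
    · simpa [h2] using h4
    · simpa using h4
  · -- An element of weight `(k, k, k)` is homogeneous because it is a multiple of `dynkin (toT x)`.
    have h1 := dynkin_toT x
    have hn : ((3 * k : ℕ) : ℂ) ≠ 0 := by exact_mod_cast (by omega)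
    rw [euler_weightSpace h] at h1
    have h2 : x = ((3 * k : ℕ) : ℂ)⁻¹ • dynkin (toT x) := by
      rw [h1, smul_smul]
      have : (((k : ℤ) + k + k : ℤ) : ℂ) = ((3 * k : ℕ) : ℂ) := by push_cast; ring
      rw [this, inv_mul_cancel₀ hn, one_smul]
    rw [h2]
    refine Submodule.smul_mem _ _ ?_
    have h3 : toT x ∈ Submodule.span ℂ (mon '' {w | w.length = 3 * k}) := by
      rw [← supp_eq_span]
      intro w hw
      have := toT_weightSpace h w hw
      have := length_eq_count w
      omega
    have h4 : Submodule.span ℂ (mon '' {w | w.length = 3 * k}) ≤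
        (homogeneous (3 * k)).comap dynkin := by
      rw [Submodule.span_le]
      rintro _ ⟨w, hw, rfl⟩
      have := rightBracket_homogeneous w
      have hw' : w.length = 3 * k := hw
      rw [hw'] at this
      simpa [dynkin_mon] using this
    exact h4 h3

/-- The dimension of a weight space, as an integer. -/
def weightDim (a b c : ℤ) : ℤ := Module.finrank ℂ (weightSpace a b c)

/-- The dimension of the space of invariants, by the index of the Dirac operator. -/
theorem finrank_invariantsOfDegree (k : ℕ) (hk : k ≠ 0) :
    (Module.finrank ℂ (invariantsOfDegree (3 * k)) : ℤ) =
      weightDim k k k + weightDim (k + 2) (k - 1) (k - 1) + weightDim (k + 1) (k + 1) (k - 2) -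
        weightDim (k + 1) (k - 1) k - weightDim k (k + 1) (k - 1) -
        weightDim (k + 2) k (k - 2) := by
  have := weightSpace_finite (a := k) (b := k) (c := k) (by omega)
  have := weightSpace_finite (a := k + 1) (b := k) (c := k - 1) (by omega)
  have := weightSpace_finite (a := k + 2) (b := k - 1) (c := k - 1) (by omega)
  have := weightSpace_finite (a := k + 1) (b := k + 1) (c := k - 2) (by omega)
  have := weightSpace_finite (a := k + 1) (b := k - 1) (c := k) (by omega)
  have := weightSpace_finite (a := k) (b := k + 1) (c := k - 1) (by omega)
  have := weightSpace_finite (a := k + 2) (b := k) (c := k - 2) (by omega)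
  have hk' : (k : ℤ) ≠ 0 := by omega
  have h1 := LinearMap.finrank_range_add_finrank_ker (dirac k)
  rw [LinearMap.range_eq_top.2 (dirac_surjective (by omega)), finrank_top] at h1
  simp only [Module.finrank_prod] at h1
  have e : LinearMap.ker (dirac k) ≃ₗ[ℂ] invariantsOfDegree (3 * k) :=
    { toFun := fun u => ⟨u.1.1.1, by
        rw [invariantsOfDegree_eq k hk]
        exact ⟨((dirac_eq_zero_iff hk' u.1).1 u.2).1, u.1.1.2⟩⟩
      map_add' := fun _ _ => rfl
      map_smul' := fun _ _ => rfl
      invFun := fun x => ⟨(⟨x.1, ((invariantsOfDegree_eq k hk).le x.2).2⟩, 0),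
        (dirac_eq_zero_iff hk' _).2 ⟨x.2.1, rfl⟩⟩
      left_inv := fun u => by
        have := ((dirac_eq_zero_iff hk' u.1).1 u.2).2
        ext : 1
        exact Prod.ext rfl this.symm
      right_inv := fun x => rfl }
  rw [e.finrank_eq] at h1
  simp only [weightDim]
  omega

/-! ### Signed words and cycle types -/

/-- The terms of the right-normed commutator of a word, each with its sign. -/
def brackets {α : Type*} : List α → List (ℤ × List α)
  | [] => []
  | [x] => [(1, [x])]
  | x :: y :: w =>
    (brackets (y :: w)).map (fun p => (p.1, x :: p.2)) ++
      (brackets (y :: w)).map (fun p => (-p.1, p.2 ++ [x]))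

theorem brackets_map {α β : Type*} (f : α → β) (w : List α) :
    brackets (w.map f) = (brackets w).map fun p => (p.1, p.2.map f) := by
  induction w with
  | nil => rfl
  | cons x w ih =>
    cases w with
    | nil => rfl
    | cons y w =>
      rw [List.map_cons] at ih
      simp [brackets, ih, Function.comp_def]

theorem perm_of_mem_brackets {α : Type*} (w : List α) : ∀ p ∈ brackets w, p.2.Perm w := by
  induction w with
  | nil => simp [brackets]
  | cons x w ih =>
    cases w with
    | nil => simp [brackets]
    | cons y w =>
      intro p hp
      simp only [brackets, List.mem_append, List.mem_map] at hp
      rcases hp with ⟨q, hq, rfl⟩ | ⟨q, hq, rfl⟩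
      · exact (ih q hq).cons x
      · exact (List.perm_append_singleton x q.2).trans ((ih q hq).cons x)

theorem toT_rightBracket (w : List (Fin 3)) :
    toT (rightBracket w) = ((brackets w).map fun p => (p.1 : ℂ) • mon p.2).sum := by
  induction w with
  | nil => simp [rightBracket, brackets]
  | cons x w ih =>
    cases w with
    | nil => simp [rightBracket, brackets]
    | cons y w =>
      rw [rightBracket, toT_lie, toT_gen, ih, brackets, List.map_append, List.sum_append,
        List.map_map, List.map_map, sub_eq_add_neg]
      congr 1
      · rw [← List.sum_map_mul_left]
        simp only [mul_smul_comm, ← mon_cons]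
        rfl
      · rw [← List.sum_map_mul_right, ← neg_one_mul, ← List.sum_map_mul_left]
        simp [Function.comp_def, mon_append]

/-- The labels `n - 1, …, 0` of the positions of a word of length `n`. -/
def labels : ℕ → List ℕ
  | 0 => []
  | n + 1 => n :: labels n

/-- The letter of a word at the position with a given label. -/
def look : List (Fin 3) → ℕ → Fin 3
  | [], _ => 0
  | x :: w, k => if k = w.length then x else look w k

theorem lt_of_mem_labels {n k : ℕ} (h : k ∈ labels n) : k < n := by
  induction n with
  | zero => simp [labels] at h
  | succ n ih =>
    rcases List.mem_cons.1 h with rfl | h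
    · exact Nat.lt_succ_self _
    · exact (ih h).trans (Nat.lt_succ_self _)

theorem nodup_labels (n : ℕ) : (labels n).Nodup := by
  induction n with
  | zero => exact List.nodup_nil
  | succ n ih => exact List.nodup_cons.2 ⟨fun h => lt_irrefl _ (lt_of_mem_labels h), ih⟩

theorem length_labels (n : ℕ) : (labels n).length = n := by
  induction n with
  | zero => rfl
  | succ n ih => rw [labels, List.length_cons, ih]

theorem map_look_labels (w : List (Fin 3)) : (labels w.length).map (look w) = w := by
  induction w with
  | nil => rfl
  | cons x w ih =>
    rw [List.length_cons, labels, List.map_cons]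
    congr 1
    · simp [look]
    · conv_rhs => rw [← ih]
      refine List.map_congr_left fun k hk => ?_
      rw [look, if_neg (lt_of_mem_labels hk).ne]

/-- Add `e` to the exponent at the position labelled `a`, for a list of exponents in the order of
`labels`. The test `Nat.beq` keeps the evaluation by the kernel cheap. -/
def addAt (a e : ℕ) : List ℕ → List ℕ
  | [] => []
  | f :: m => bif Nat.beq a m.length then (f + e) :: m else f :: addAt a e m

/-- The total exponents of the cycles of the permutation `u` of the labels below `n`, if the
position with label `k` carries the exponent listed in `m`. The largest label is removed from its
cycle, and its exponent passed on to its image. The lists are in the order of `labels`. -/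
def cycles : ℕ → List ℕ → List ℕ → List ℕ
  | n + 1, a :: t, e :: m =>
    bif Nat.beq a n then e :: cycles n t m
    else cycles n (t.map fun k => bif Nat.beq k n then a else k) (addAt a e m)
  | _, _, _ => []

theorem cond_beq {α : Type*} (a b : ℕ) (p q : α) :
    (bif Nat.beq a b then p else q) = if a = b then p else q := by
  by_cases h : a = b
  · subst h
    simp
  · have hb : Nat.beq a b = false := by rwa [← Bool.not_eq_true, Nat.beq_eq]
    rw [hb, if_neg h, cond_false]

section WeightedCount

variable {R : Type*} [CommRing R] (x : Fin 3 → R)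

/-- The monomial of a word, the letters being raised to the exponents `m`. -/
def wordWeight (w : List (Fin 3)) (m : List ℕ) : R := (List.zipWith (fun c e => x c ^ e) w m).prod

/-- The power sum `∑ x_i ^ e`. -/
def powerSum (e : ℕ) : R := ∑ i, x i ^ e

/-- The weighted number of words fixed by the permutation `u` of the positions. -/
def fixedSum (n : ℕ) (u m : List ℕ) : R :=
  ∑ w ∈ words n, if u.map (look w) = w then wordWeight x w m else 0

theorem length_addAt (a e : ℕ) (m : List ℕ) : (addAt a e m).length = m.length := by
  induction m with
  | nil => rfl
  | cons f m ih =>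
    rw [addAt]
    cases Nat.beq a m.length <;> simp [ih]

theorem wordWeight_addAt (a e : ℕ) (w : List (Fin 3)) (m : List ℕ) (hw : w.length = m.length)
    (ha : a < m.length) : wordWeight x w (addAt a e m) = x (look w a) ^ e * wordWeight x w m := by
  induction m generalizing w with
  | nil => simp at ha
  | cons f m ih =>
    cases w with
    | nil => simp at hw
    | cons c w =>
      have hw' : w.length = m.length := by simpa using hw
      rw [addAt, look, hw', cond_beq]
      by_cases h : a = m.length
      · rw [if_pos h, if_pos h]
        simp only [wordWeight, List.zipWith_cons_cons, List.prod_cons]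
        ring
      · have ih' := ih w hw' (by simp at ha; omega)
        rw [if_neg h, if_neg h]
        simp only [wordWeight, List.zipWith_cons_cons, List.prod_cons] at ih' ⊢
        rw [ih']
        ring

/-- A word is fixed by a permutation if it is constant on the cycles, so the weighted number of fixed
words is a product of power sums. -/
theorem fixedSum_eq (n : ℕ) (u m : List ℕ) (hu : u.length = n) (hm : m.length = n)
    (hn : u.Nodup) (hlt : ∀ k ∈ u, k < n) :
    fixedSum x n u m = ((cycles n u m).map (powerSum x)).prod := by
  induction n generalizing u m with
  | zero =>
    obtain rfl := List.length_eq_zero_iff.1 hu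
    obtain rfl := List.length_eq_zero_iff.1 hm
    simp [fixedSum, words, wordWeight, cycles]
  | succ n ih =>
    obtain ⟨a, t, rfl⟩ := List.exists_cons_of_length_eq_add_one hu
    obtain ⟨e, m, rfl⟩ := List.exists_cons_of_length_eq_add_one hm
    have ht : t.length = n := by simpa using hu
    have hm' : m.length = n := by simpa using hm
    obtain ⟨hat, htn⟩ := List.nodup_cons.1 hn
    rw [fixedSum, sum_words_succ, cycles, cond_beq]
    simp only [cond_beq]
    have han : a < n + 1 := hlt a (by simp)
    have htl : ∀ k ∈ t, k < n + 1 := fun k hk => hlt k (by simp [hk])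
    by_cases h : a = n
    · rw [if_pos h, List.map_cons, List.prod_cons]
      have htl' : ∀ k ∈ t, k < n := fun k hk => by
        have := htl k hk
        have : k ≠ a := fun hka => hat (hka ▸ hk)
        omega
      rw [← ih t m ht hm' htn htl', powerSum, fixedSum, Finset.sum_mul_sum]
      refine Finset.sum_congr rfl fun c _ => Finset.sum_congr rfl fun w hw => ?_
      have hwl := mem_words.1 hw
      have h1 : t.map (look (c :: w)) = t.map (look w) := List.map_congr_left fun k hk => by
        rw [look, if_neg (by have := htl' k hk; omega)]
      have h2 : look (c :: w) a = c := by rw [look, if_pos (by omega)]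
      rw [List.map_cons, h1, h2]
      simp only [List.cons.injEq, true_and, wordWeight, List.zipWith_cons_cons, List.prod_cons]
      split_ifs <;> simp
    · rw [if_neg h]
      -- The letter at the largest label equals the letter at its image `a`; eliminate it.
      rw [← ih (t.map fun k => if k = n then a else k) (addAt a e m) (by simpa using ht)
        (by rw [length_addAt, hm']) ?_ ?_, fixedSum, Finset.sum_comm]
      · refine Finset.sum_congr rfl fun w hw => ?_
        have hwl := mem_words.1 hw
        rw [Finset.sum_eq_single (look w a)]
        · have h1 : t.map (look (look w a :: w)) =
              (t.map fun k => if k = n then a else k).map (look w) := by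
            rw [List.map_map]
            refine List.map_congr_left fun k _ => ?_
            rw [look, hwl, Function.comp_apply]
            split_ifs <;> rfl
          have h2 : look (look w a :: w) a = look w a := by rw [look, if_neg (by omega)]
          rw [List.map_cons, h1, h2, wordWeight_addAt x a e w m (by omega) (by omega)]
          simp only [List.cons.injEq, true_and, wordWeight, List.zipWith_cons_cons, List.prod_cons]
        · intro c _ hc
          rw [if_neg]
          intro h1
          rw [List.map_cons, List.cons.injEq, look, if_neg (by omega)] at h1
          exact hc h1.1.symm
        · simp
      · refine List.Nodup.map_on (fun k hk l hl hkl => ?_) htn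
        have hka : k ≠ a := fun hka => hat (hka ▸ hk)
        have hla : l ≠ a := fun hla => hat (hla ▸ hl)
        split_ifs at hkl <;> omega
      · intro k hk
        obtain ⟨l, hl, rfl⟩ := List.mem_map.1 hk
        have := htl l hl
        split_ifs <;> omega

theorem finsetSum_listSum {α β : Type*} (s : Finset α) (l : List β) (f : α → β → R) :
    ∑ w ∈ s, (l.map (f w)).sum = (l.map fun p => ∑ w ∈ s, f w p).sum := by
  induction l with
  | nil => simp
  | cons p l ih => simp [Finset.sum_add_distrib, ih]

/-- The coefficient of a word in its own right-normed commutator. -/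
def selfCoeff (w : List (Fin 3)) : ℤ :=
  ((brackets w).map fun p => if p.2 = w then p.1 else 0).sum

theorem co_toT_rightBracket (w : List (Fin 3)) :
    co w (toT (rightBracket w)) = (selfCoeff w : ℂ) := by
  rw [toT_rightBracket, map_list_sum, List.map_map, selfCoeff, Int.cast_list_sum, List.map_map]
  congr 1
  refine List.map_congr_left fun p _ => ?_
  simp only [Function.comp_apply, map_smul, co_mon, smul_eq_mul]
  split_ifs <;> simp

theorem wordWeight_one (w : List (Fin 3)) :
    wordWeight x w (List.replicate w.length 1) = (w.map x).prod := by
  induction w with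
  | nil => rfl
  | cons c w ih =>
    simp only [wordWeight, List.length_cons, List.replicate_succ, List.zipWith_cons_cons,
      List.prod_cons, List.map_cons, pow_one] at ih ⊢
    rw [ih]

/-- The weighted trace of the Dynkin operator, in terms of cycle types. -/
theorem sum_selfCoeff (n : ℕ) :
    ∑ w ∈ words n, (selfCoeff w : R) * (w.map x).prod =
      ((brackets (labels n)).map fun p =>
        (p.1 : R) * ((cycles n p.2 (List.replicate n 1)).map (powerSum x)).prod).sum := by
  have h1 : ∀ w ∈ words n, (selfCoeff w : R) * (w.map x).prod =
      ((brackets (labels n)).map fun p => (p.1 : R) *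
        if p.2.map (look w) = w then wordWeight x w (List.replicate n 1) else 0).sum := by
    intro w hw
    have hwl := mem_words.1 hw
    have h2 : brackets w = (brackets (labels n)).map fun p => (p.1, p.2.map (look w)) := by
      rw [← brackets_map, ← hwl, map_look_labels]
    rw [selfCoeff, h2, List.map_map, Int.cast_list_sum, List.map_map, ← List.sum_map_mul_right]
    congr 1
    refine List.map_congr_left fun p _ => ?_
    rw [← hwl, wordWeight_one]
    simp only [Function.comp_apply]
    split_ifs <;> simp
  rw [Finset.sum_congr rfl h1, finsetSum_listSum]
  congr 1
  refine List.map_congr_left fun p hp => ?_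
  have hperm := perm_of_mem_brackets _ p hp
  rw [← Finset.mul_sum, ← fixedSum_eq x n p.2 _ (by rw [hperm.length_eq, length_labels])
    (by simp) (hperm.nodup_iff.2 (nodup_labels n))
    fun k hk => lt_of_mem_labels (hperm.mem_iff.1 hk)]
  rfl

end WeightedCount

/-! ### Collecting cycle types -/

/-- Insertion of a number into a sorted list. -/
def insertSorted (a : ℕ) : List ℕ → List ℕ
  | [] => [a]
  | b :: l => bif Nat.ble a b then a :: b :: l else b :: insertSorted a l

/-- Insertion sort. -/
def sortList : List ℕ → List ℕ
  | [] => []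
  | a :: l => insertSorted a (sortList l)

/-- Add a signed cycle type to a list of cycle types with multiplicities. -/
def addType (s : ℤ) (t : List ℕ) : List (ℤ × List ℕ) → List (ℤ × List ℕ)
  | [] => [(s, t)]
  | p :: l => bif t == p.2 then (p.1 + s, p.2) :: l else p :: addType s t l

/-- Merge two lists of cycle types with multiplicities. -/
def mergeTypes : List (ℤ × List ℕ) → List (ℤ × List ℕ) → List (ℤ × List ℕ)
  | [], l => l
  | p :: k, l => addType p.1 p.2 (mergeTypes k l)

/-- The values of `f` at the words `l.reverse ++ u ++ r`, for the terms `u` of the right-normed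
commutator of a word, collected with multiplicities. Equal values are merged at every branching, so
that the lists remain short. -/
def collectTypes {α : Type*} (f : List α → List ℕ) :
    List α → List α → List α → ℤ → List (ℤ × List ℕ)
  | [], _, _, _ => []
  | [x], l, r, s => [(s, f (l.reverse ++ x :: r))]
  | x :: y :: w, l, r, s =>
    mergeTypes (collectTypes f (y :: w) (x :: l) r s) (collectTypes f (y :: w) l (x :: r) (-s))

/-- The cycle types of the signed permutations occurring in the right-normed commutator of `n`
letters, with their nonzero multiplicities. -/
def cycleTypes (n : ℕ) : List (ℤ × List ℕ) :=
  (collectTypes (fun u => sortList (cycles n u (List.replicate n 1))) (labels n) [] [] 1).filter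
    fun p => p.1 != 0

section Eval

variable {R : Type*} [CommRing R] (g : ℕ → R)

/-- The linear combination of products described by a list of types. -/
def evalTypes (l : List (ℤ × List ℕ)) : R := (l.map fun p => (p.1 : R) * (p.2.map g).prod).sum

theorem insertSorted_perm (a : ℕ) (l : List ℕ) : (insertSorted a l).Perm (a :: l) := by
  induction l with
  | nil => exact List.Perm.refl _
  | cons b l ih =>
    rw [insertSorted]
    cases Nat.ble a b
    · exact (ih.cons b).trans (List.Perm.swap a b l)
    · exact List.Perm.refl _

theorem sortList_perm (l : List ℕ) : (sortList l).Perm l := by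
  induction l with
  | nil => exact List.Perm.refl _
  | cons a l ih => exact (insertSorted_perm a _).trans (ih.cons a)

theorem evalTypes_addType (s : ℤ) (t : List ℕ) (l : List (ℤ × List ℕ)) :
    evalTypes g (addType s t l) = s * (t.map g).prod + evalTypes g l := by
  induction l with
  | nil => simp [addType, evalTypes]
  | cons p l ih =>
    rw [addType]
    by_cases h : t = p.2
    · rw [beq_iff_eq.2 h, cond_true]
      simp only [evalTypes, List.map_cons, List.sum_cons, Int.cast_add, h]
      ring
    · rw [beq_eq_false_iff_ne.2 h, cond_false]
      simp only [evalTypes, List.map_cons, List.sum_cons] at ih ⊢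
      rw [ih]
      ring

theorem evalTypes_mergeTypes (k l : List (ℤ × List ℕ)) :
    evalTypes g (mergeTypes k l) = evalTypes g k + evalTypes g l := by
  induction k with
  | nil => simp [mergeTypes, evalTypes]
  | cons p k ih =>
    rw [mergeTypes, evalTypes_addType, ih]
    simp [evalTypes, add_assoc]

theorem evalTypes_collectTypes {α : Type*} (f : List α → List ℕ) (w l r : List α) (s : ℤ) :
    evalTypes g (collectTypes f w l r s) = ((brackets w).map fun p =>
      ((s * p.1 : ℤ) : R) * ((f (l.reverse ++ p.2 ++ r)).map g).prod).sum := by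
  induction w generalizing l r s with
  | nil => rfl
  | cons x w ih =>
    cases w with
    | nil => simp [collectTypes, brackets, evalTypes]
    | cons y w =>
      rw [collectTypes, evalTypes_mergeTypes, ih, ih, brackets, List.map_append, List.sum_append,
        List.map_map, List.map_map]
      simp [Function.comp_def]

theorem evalTypes_filter (l : List (ℤ × List ℕ)) :
    evalTypes g (l.filter fun p => p.1 != 0) = evalTypes g l := by
  induction l with
  | nil => rfl
  | cons p l ih =>
    rw [List.filter_cons]
    simp only [evalTypes] at ih ⊢
    by_cases h : p.1 = 0
    · simp [h, ih]
    · simp [h, ih]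

theorem evalTypes_cycleTypes (n : ℕ) :
    evalTypes g (cycleTypes n) = ((brackets (labels n)).map fun p =>
      (p.1 : R) * ((cycles n p.2 (List.replicate n 1)).map g).prod).sum := by
  rw [cycleTypes, evalTypes_filter, evalTypes_collectTypes]
  congr 1
  refine List.map_congr_left fun p _ => ?_
  rw [((sortList_perm _).map g).prod_eq]
  simp

end Eval

/-! ### Coefficients -/

open MvPolynomial in
theorem prod_map_X (w : List (Fin 3)) : (w.map (X : Fin 3 → MvPolynomial (Fin 3) ℤ)).prod =
    monomial (Finsupp.equivFunOnFinite.symm fun i => w.count i) 1 := by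
  induction w with
  | nil =>
    rw [List.map_nil, List.prod_nil, ← C_1, C_apply]
    refine congrArg (fun s => monomial s (1 : ℤ)) (Finsupp.ext fun i => ?_)
    simp
  | cons c w ih =>
    rw [List.map_cons, List.prod_cons, ih, X, monomial_mul, one_mul]
    refine congrArg (fun s => monomial s (1 : ℤ)) (Finsupp.ext fun i => ?_)
    simp [List.count_cons, Finsupp.single_apply, add_comm]

/-- The coefficient of the monomial with exponents `μ` in `(∑ X_i ^ d) ^ k`. -/
def powerCoeff (d k : ℕ) (μ : Fin 3 → ℕ) : ℕ :=
  if (∀ i, d ∣ μ i) ∧ ∑ i, μ i / d = k then Nat.multinomial Finset.univ fun i => μ i / d else 0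

open MvPolynomial in
theorem coeff_powerSum_pow (d k : ℕ) (hd : 0 < d) (μ : Fin 3 → ℕ) :
    coeff (Finsupp.equivFunOnFinite.symm μ)
      (powerSum (X : Fin 3 → MvPolynomial (Fin 3) ℤ) d ^ k) = powerCoeff d k μ := by
  have h1 : ∀ κ : Fin 3 → ℕ, ∏ i, ((X i : MvPolynomial (Fin 3) ℤ) ^ d) ^ κ i =
      monomial (Finsupp.equivFunOnFinite.symm fun i => d * κ i) 1 := fun κ => by
    rw [monomial_eq, C_1, one_mul, Finsupp.prod_fintype _ _ fun i => pow_zero _]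
    exact Finset.prod_congr rfl fun i _ => (pow_mul _ _ _).symm
  rw [powerSum, Finset.sum_pow_eq_sum_piAntidiag, coeff_sum]
  simp only [h1, ← C_eq_coe_nat, coeff_C_mul, coeff_monomial, mul_ite, mul_one, mul_zero,
    EmbeddingLike.apply_eq_iff_eq]
  rw [powerCoeff]
  split_ifs with h
  · obtain ⟨h2, h3⟩ := h
    rw [Finset.sum_eq_single fun i => μ i / d]
    · rw [if_pos (funext fun i => Nat.mul_div_cancel' (h2 i))]
    · intro κ _ hκ
      rw [if_neg]
      rintro rfl
      exact hκ (funext fun i => (Nat.mul_div_cancel_left _ hd).symm)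
    · intro h4
      exact absurd (Finset.mem_piAntidiag.2 ⟨h3, fun i _ => Finset.mem_univ i⟩) h4
  · rw [Nat.cast_zero]
    refine Finset.sum_eq_zero fun κ hκ => if_neg ?_
    rintro rfl
    refine h ⟨fun i => dvd_mul_right _ _, ?_⟩
    simp only [Nat.mul_div_cancel_left _ hd]
    exact (Finset.mem_piAntidiag.1 hκ).1

/-- The dimension of a weight space, once the cycle types of the Dynkin operator are known. -/
theorem mul_weightDim (n a b c : ℕ) (hn : n ≠ 0) (h : a + b + c = n) (l : List (ℤ × ℕ × ℕ))
    (hl : cycleTypes n = l.map fun p => (p.1, List.replicate p.2.1 p.2.2))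
    (hpos : ∀ p ∈ l, 0 < p.2.2) :
    (n : ℤ) * weightDim a b c =
      (l.map fun p => p.1 * (powerCoeff p.2.2 p.2.1 ![a, b, c] : ℤ)).sum := by
  have h1 := (weightSpace_trace (n := n) (a := a) (b := b) (c := c) hn (by exact_mod_cast h)).2
  simp only [co_toT_rightBracket] at h1
  have h2 : (n : ℤ) * weightDim a b c =
      ∑ w ∈ contentWords n a b c, selfCoeff w := by
    rw [weightDim]
    exact_mod_cast h1
  have h3 := congrArg (MvPolynomial.lcoeff ℤ (Finsupp.equivFunOnFinite.symm ![a, b, c]))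
    ((sum_selfCoeff (MvPolynomial.X : Fin 3 → MvPolynomial (Fin 3) ℤ) n).trans
      (evalTypes_cycleTypes _ n).symm)
  rw [hl, evalTypes, List.map_map, map_list_sum, List.map_map, map_sum] at h3
  rw [h2, contentWords, Finset.sum_filter]
  refine Eq.trans (Finset.sum_congr rfl fun w _ => ?_) (h3.trans ?_)
  · rw [MvPolynomial.lcoeff_apply, prod_map_X, ← map_intCast (MvPolynomial.C : ℤ →+* MvPolynomial (Fin 3) ℤ),
      MvPolynomial.coeff_C_mul, MvPolynomial.coeff_monomial, mul_ite, mul_one, mul_zero]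
    refine if_congr ?_ (by simp) rfl
    rw [EmbeddingLike.apply_eq_iff_eq, funext_iff, Fin.forall_fin_succ, Fin.forall_fin_succ,
      Fin.forall_fin_succ]
    simp
  · congr 1
    refine List.map_congr_left fun p hp => ?_
    simp only [Function.comp_apply, List.map_replicate, List.prod_replicate]
    rw [← map_intCast (MvPolynomial.C : ℤ →+* MvPolynomial (Fin 3) ℤ),
      MvPolynomial.lcoeff_apply, MvPolynomial.coeff_C_mul, coeff_powerSum_pow _ _ (hpos p hp)]
    simp

/-! ### Invariants of small degree -/

/-- The entry `(s, k, d)` stands for `k` cycles of length `d`, with multiplicity `s`. -/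
theorem cycleTypes_three : cycleTypes 3 = [(-1, 1, 3), (1, 3, 1)].map
    fun p : ℤ × ℕ × ℕ => (p.1, List.replicate p.2.1 p.2.2) := by decide +kernel

theorem cycleTypes_six : cycleTypes 6 = [(-1, 3, 2), (1, 1, 6), (-1, 2, 3), (1, 6, 1)].map
    fun p : ℤ × ℕ × ℕ => (p.1, List.replicate p.2.1 p.2.2) := by decide +kernel

theorem cycleTypes_nine : cycleTypes 9 = [(-1, 3, 3), (1, 9, 1)].map
    fun p : ℤ × ℕ × ℕ => (p.1, List.replicate p.2.1 p.2.2) := by decide +kernel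

theorem cycleTypes_twelve : cycleTypes 12 = [(-1, 6, 2), (1, 2, 6), (-1, 4, 3), (1, 12, 1)].map
    fun p : ℤ × ℕ × ℕ => (p.1, List.replicate p.2.1 p.2.2) := by decide +kernel

/-- There are no words with a negative number of letters. -/
theorem weightDim_of_neg {a b c : ℤ} (h : 0 < a + b + c) (hc : c < 0) :
    weightDim a b c = 0 := by
  have h1 := (weightSpace_trace (n := (a + b + c).toNat) (a := a) (b := b) (c := c)
    (by omega) (by omega)).2
  have h2 : contentWords (a + b + c).toNat a b c = ∅ :=
    Finset.filter_eq_empty_iff.2 fun w _ hw => by omega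
  rw [h2, Finset.sum_empty] at h1
  have h3 : (((a + b + c).toNat : ℕ) : ℂ) ≠ 0 := by exact_mod_cast (by omega)
  have h4 := (mul_eq_zero.1 h1).resolve_left h3
  rw [weightDim]
  exact_mod_cast h4

theorem finrank_three : Module.finrank ℂ (invariantsOfDegree 3) = 0 := by
  have h : (Module.finrank ℂ (invariantsOfDegree 3) : ℤ) = _ :=
    finrank_invariantsOfDegree 1 one_ne_zero
  have d := fun a b c h => mul_weightDim 3 a b c three_ne_zero h _ cycleTypes_three (by decide)
  have e1 := (d 1 1 1 rfl).trans (c := 6) (by decide +kernel)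
  have e2 := (d 3 0 0 rfl).trans (c := 0) (by decide +kernel)
  have e3 := (d 2 0 1 rfl).trans (c := 3) (by decide +kernel)
  have e4 := (d 1 2 0 rfl).trans (c := 3) (by decide +kernel)
  have e5 := weightDim_of_neg (a := 2) (b := 2) (c := -1) (by norm_num) (by norm_num)
  have e6 := weightDim_of_neg (a := 3) (b := 1) (c := -1) (by norm_num) (by norm_num)
  norm_num at h e1 e2 e3 e4 e5 e6
  omega

theorem finrank_six : Module.finrank ℂ (invariantsOfDegree 6) = 0 := by
  have h : (Module.finrank ℂ (invariantsOfDegree 6) : ℤ) = _ :=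
    finrank_invariantsOfDegree 2 two_ne_zero
  have d := fun a b c h => mul_weightDim 6 a b c (by norm_num) h _ cycleTypes_six (by decide)
  have e1 := (d 2 2 2 rfl).trans (c := 84) (by decide +kernel)
  have e2 := (d 4 1 1 rfl).trans (c := 30) (by decide +kernel)
  have e3 := (d 3 3 0 rfl).trans (c := 18) (by decide +kernel)
  have e4 := (d 3 1 2 rfl).trans (c := 60) (by decide +kernel)
  have e5 := (d 2 3 1 rfl).trans (c := 60) (by decide +kernel)
  have e6 := (d 4 2 0 rfl).trans (c := 12) (by decide +kernel)
  norm_num at h e1 e2 e3 e4 e5 e6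
  omega

theorem finrank_nine : Module.finrank ℂ (invariantsOfDegree 9) = 4 := by
  have h : (Module.finrank ℂ (invariantsOfDegree 9) : ℤ) = _ :=
    finrank_invariantsOfDegree 3 three_ne_zero
  have d := fun a b c h => mul_weightDim 9 a b c (by norm_num) h _ cycleTypes_nine (by decide)
  have e1 := (d 3 3 3 rfl).trans (c := 1674) (by decide +kernel)
  have e2 := (d 5 2 2 rfl).trans (c := 756) (by decide +kernel)
  have e3 := (d 4 4 1 rfl).trans (c := 630) (by decide +kernel)
  have e4 := (d 4 2 3 rfl).trans (c := 1260) (by decide +kernel)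
  have e5 := (d 3 4 2 rfl).trans (c := 1260) (by decide +kernel)
  have e6 := (d 5 3 1 rfl).trans (c := 504) (by decide +kernel)
  norm_num at h e1 e2 e3 e4 e5 e6
  omega

theorem finrank_twelve : Module.finrank ℂ (invariantsOfDegree 12) = 35 := by
  have h : (Module.finrank ℂ (invariantsOfDegree 12) : ℤ) = _ :=
    finrank_invariantsOfDegree 4 four_ne_zero
  have d := fun a b c h =>
    mul_weightDim 12 a b c (by norm_num) h _ cycleTypes_twelve (by decide)
  have e1 := (d 4 4 4 rfl).trans (c := 34560) (by decide +kernel)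
  have e2 := (d 6 3 3 rfl).trans (c := 18468) (by decide +kernel)
  have e3 := (d 5 5 2 rfl).trans (c := 16632) (by decide +kernel)
  have e4 := (d 5 3 4 rfl).trans (c := 27720) (by decide +kernel)
  have e5 := (d 4 5 3 rfl).trans (c := 27720) (by decide +kernel)
  have e6 := (d 6 4 2 rfl).trans (c := 13800) (by decide +kernel)
  norm_num at h e1 e2 e3 e4 e5 e6
  omega

/-- The degree of an invariant is a multiple of three. -/
theorem invariantsOfDegree_eq_bot {n : ℕ} (hn : ¬ 3 ∣ n) : invariantsOfDegree n = ⊥ := by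
  rw [Submodule.eq_bot_iff]
  rintro x ⟨hx, hxn⟩
  obtain ⟨-, h1, h2⟩ := (mem_invariants_iff x).1 hx
  refine eq_zero_of_toT_eq_zero hxn (ext_co fun w => ?_)
  rw [map_zero]
  by_contra hw
  have hlen : w.length = n := toT_homogeneous hxn w hw
  have key : ∀ i j : Fin 3, unitAct i i x = unitAct j j x → w.count i = w.count j := by
    intro i j h
    have h3 := congrArg (fun y => co w (toT y)) h
    simp only [toT_unitAct, co_actT_diag] at h3
    exact_mod_cast mul_right_cancel₀ hw h3
  have h3 := key 0 1 h1
  have h4 := key 1 2 h2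
  have h5 := length_eq_count w
  omega

theorem invariantsOfDegree_eq_bot_of_finrank {n : ℕ} (hn : n ≠ 0)
    (h : Module.finrank ℂ (invariantsOfDegree (3 * n)) = 0) : invariantsOfDegree (3 * n) = ⊥ := by
  have h1 := weightSpace_finite (a := n) (b := n) (c := n) (by omega)
  have h2 : FiniteDimensional ℂ (invariantsOfDegree (3 * n)) := by
    rw [invariantsOfDegree_eq n hn]
    infer_instance
  exact Submodule.finrank_eq_zero.1 h

theorem invariantsOfDegree_of_lt_nine {n : ℕ} (hn : n < 9) : invariantsOfDegree n = ⊥ := by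
  by_cases h : 3 ∣ n
  · obtain ⟨k, rfl⟩ := h
    have hk : k < 3 := by omega
    interval_cases k
    · rw [invariantsOfDegree, homogeneous_zero, inf_bot_eq]
    · exact invariantsOfDegree_eq_bot_of_finrank one_ne_zero finrank_three
    · exact invariantsOfDegree_eq_bot_of_finrank two_ne_zero finrank_six
  · exact invariantsOfDegree_eq_bot h

/-- The elements of `L` with components in degree `9` and in degrees at least `18` only. -/
def nineOrLarge : LieSubalgebra ℂ L :=
  { (supp fun w => w.length = 9 ∨ 18 ≤ w.length).comap (toT : L →ₗ[ℂ] T) with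
    lie_mem' := fun {x y} hx hy => by
      have hx' : toT x ∈ supp fun w => w.length = 9 ∨ 18 ≤ w.length := hx
      have hy' : toT y ∈ supp fun w => w.length = 9 ∨ 18 ≤ w.length := hy
      change toT ⁅x, y⁆ ∈ supp fun w => w.length = 9 ∨ 18 ≤ w.length
      rw [toT_lie]
      refine sub_mem (mul_mem_supp ?_ hx' hy') (mul_mem_supp ?_ hy' hx') <;>
      · intro u v hu hv
        rw [List.length_append]
        omega }

/-- The invariants of degree less than `12` have degree `9`, so the Lie algebra which they generate
has no component in degree `12`. -/
theorem lowerInvariants_le : lowerInvariants 12 ≤ nineOrLarge := by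
  refine LieSubalgebra.lieSpan_le.2 ?_
  rintro x ⟨k, hk, hx⟩
  by_cases h : k = 9
  · subst h
    exact fun w hw => Or.inl (toT_homogeneous hx.2 w hw)
  · have : invariantsOfDegree k = ⊥ := by
      rcases Nat.lt_or_ge k 9 with h9 | h9
      · exact invariantsOfDegree_of_lt_nine h9
      · exact invariantsOfDegree_eq_bot (by omega)
    rw [this, Submodule.mem_bot] at hx
    rw [hx]
    exact zero_mem _

end FreeLieInvariants

end

theorem mainTheorem4 :
    Module.finrank ℂ (FreeLieInvariants.invariantsOfDegree 12) = 35 ∧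
      IsLeast {n : ℕ | FreeLieInvariants.invariantsOfDegree n ≠ ⊥} 9 ∧
      ∀ Z ∈ FreeLieInvariants.invariantsOfDegree 12, Z ≠ 0 →
        FreeLieInvariants.IsPrimitive 12 Z := by
  refine ⟨FreeLieInvariants.finrank_twelve, ⟨fun h => ?_, fun n hn => ?_⟩, fun Z hZ h0 =>
    ⟨hZ, fun h => h0 ?_⟩⟩
  · have h1 := FreeLieInvariants.finrank_nine
    rw [h, finrank_bot] at h1
    omega
  · by_contra h
    exact hn (FreeLieInvariants.invariantsOfDegree_of_lt_nine (by omega))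
  · refine FreeLieInvariants.eq_zero_of_toT_eq_zero hZ.2 (FreeLieInvariants.ext_co fun w => ?_)
    rw [map_zero]
    by_contra hw
    have h1 : w.length = 12 := FreeLieInvariants.toT_homogeneous hZ.2 w hw
    have h2 : w.length = 9 ∨ 18 ≤ w.length := FreeLieInvariants.lowerInvariants_le h w hw
    omega
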